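/- Let $d\ge 0$ and let $\mathbb{P}^d$ be the space of lines of $\mathbb{R}^{d+1}$. An open set $\Omega\subset\mathbb{P}^d$ is properly convex if it is contained, as a bounded convex subset, in some affine chart (the complement of a projective hyperplane). Let $X$ be the set of properly convex open subsets of $\mathbb{P}^d$, with the Hausdorff topology. A projective metric $F$ assigns to each $\Omega\in X$ and $x\in\Omega$ a norm $F_\Omega(x)$ on $T_x\Omega=T_x\mathbb{P}^d$. It is natural if it is invariant under $\mathrm{PGL}_{d+1}(\mathbb{R})$ and if $(\Omega,x,v)\mapsto F_\Omega(x)(v)$ is continuous on $\{(\Omega,x,v): \Omega\in X,\ x\in\Omega,\ v\in T_x\Omega\}\subset X\times T\mathbb{P}^d$. The distance $d^F_\Omega(x,y)$ that comes from $F$ is the infimum of the $F_\Omega$-lengths of the $C^1$ paths from $x$ to $y$ in $\Omega$. For $\Omega\in X$, in an affine chart in which $\Omega$ is bounded and for a Euclidean norm $|\cdot|$ on it, the Hilbert distance is $$d^{\mathrm{Hil}}_\Omega(x,y)=\tfrac12\ln\frac{|py|\,|qx|}{|px|\,|qy|}\quad(x\ne y),\qquad d^{\mathrm{Hil}}_\Omega(x,x)=0,$$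 where $p,q$ are the points at which the line $(xy)$ meets $\partial\Omega$, in the order $p,x,y,q$. The Hilbert norm is $$F^{\mathrm{Hil}}_\Omega(x)(v)=\frac{|v|}{2}\Big(\frac1{|xp^-|}+\frac1{|xp^+|}\Big)\quad(v\ne0),\qquad F^{\mathrm{Hil}}_\Omega(x)(0)=0,$$ where $p^\pm$ are the points at which the line through $x$ directed by $v$ meets $\partial\Omega$. **Proposition.** (1) For every $d$ and every natural projective metric $F$ on the properly convex open subsets of $\mathbb{P}^d$ there are constants $0<a_d<b_d$ such that $$a_d\,F_\Omega(x)(v)\le F^{\mathrm{Hil}}_\Omega(x)(v)\le b_d\,F_\Omega(x)(v)$$ for all $\Omega\in X$, $x\in\Omega$, $v\in T_x\Omega$, and also $$a_d\,d^F_\Omega(x,y)\le d^{\mathrm{Hil}}_\Omega(x,y)\le b_d\,d^F_\Omega(x,y)$$ for all $\Omega\in X$ and $x,y\in\Omega$. (2) For any two natural projective metrics $F,F'$ in dimension $d$ there are constants $0<a<b$ such that $a\,d^F_\Omega(x,y)\le d^{F'}_\Omega(x,y)\le b\,d^F_\Omega(x,y)$ for all $\Omega\in X$ and $x,y\in\Omega$;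 that is, $(\Omega,d^F_\Omega)$ and $(\Omega,d^{F'}_\Omega)$ are bi-Lipschitz equivalent through the identity map. -/

import Mathlib

open Set Topology
open scoped LinearAlgebra.Projectivization ContDiff

noncomputable section

namespace HilbertGeometry

/-- The vector space `ℝ^(d+1)`, with its Euclidean structure. -/
abbrev Vec (d : ℕ) : Type := EuclideanSpace ℝ (Fin (d + 1))

/-- The real projective space of dimension `d`: the lines of `ℝ^(d+1)`. -/
abbrev Proj (d : ℕ) : Type := ℙ ℝ (Vec d)

/-- The usual topology of the projective space: the quotient topology from `ℝ^(d+1) ∖ {0}`. -/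
instance instTopologicalSpaceProj (d : ℕ) : TopologicalSpace (Proj d) :=
  TopologicalSpace.coinduced
    (fun u : {u : Vec d // u ≠ 0} => Projectivization.mk ℝ u.1 u.2) inferInstance

variable {d : ℕ}

/-! ### Affine charts and properly convex open sets -/

/-- The affine chart of a nonzero linear form `f`: the complement of the projective hyperplane
`f = 0`. -/
def affineChart (f : Module.Dual ℝ (Vec d)) : Set (Proj d) :=
  {x | f x.rep ≠ 0}

/-- The affine structure of the chart of `f`: a point is identified with its unique
representative in the affine hyperplane `{f = 1}` of `ℝ^(d+1)`. -/
def chartCoord (f : Module.Dual ℝ (Vec d)) (x : Proj d) : Vec d :=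
  (f x.rep)⁻¹ • x.rep

/-- A properly convex set: convex and bounded in some affine chart. -/
def IsProperlyConvex (S : Set (Proj d)) : Prop :=
  ∃ f : Module.Dual ℝ (Vec d), f ≠ 0 ∧ S ⊆ affineChart f ∧
    Convex ℝ (chartCoord f '' S) ∧ Bornology.IsBounded (chartCoord f '' S)

/-- The set `X` of properly convex open subsets of the projective space. -/
@[ext]
structure ProperlyConvexOpen (d : ℕ) : Type where
  carrier : Set (Proj d)
  isOpen : IsOpen carrier
  properlyConvex : IsProperlyConvex carrier

instance : Membership (Proj d) (ProperlyConvexOpen d) := ⟨fun Ω x => x ∈ Ω.carrier⟩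

/-- The unit vectors that span a line in `S`. -/
def unitLift (S : Set (Proj d)) : Set (Vec d) :=
  {u | ‖u‖ = 1 ∧ ∃ h : u ≠ 0, Projectivization.mk ℝ u h ∈ S}

/-- The Hausdorff topology on `X`. The Hausdorff distance between `unitLift S` and `unitLift S'`
is the Hausdorff distance between `S` and `S'` for the metric `min (‖u - v‖) (‖u + v‖)`
(`u`, `v` unit representatives) of the projective space. -/
instance instTopologicalSpaceProperlyConvexOpen : TopologicalSpace (ProperlyConvexOpen d) :=
  (PseudoEMetricSpace.induced (fun Ω : ProperlyConvexOpen d => unitLift Ω.carrier)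
    PseudoEMetricSpace.hausdorff).toUniformSpace.toTopologicalSpace

/-! ### The tangent bundle of the projective space -/

/-- The tangent space of the projective space at the line `x`: the space of linear maps from `x`
to `ℝ^(d+1) / x`. -/
abbrev ProjTangent (x : Proj d) : Type :=
  x.submodule →ₗ[ℝ] (Vec d ⧸ x.submodule)

/-- The differential at `u ≠ 0`, in the direction `w`, of the projection `u ↦ [u]`: the linear map
`ℝ u → ℝ^(d+1) / ℝ u` that sends `u` to the class of `w` (see `mkDeriv_apply_self`). -/
def mkDeriv (u : Vec d) (hu : u ≠ 0) (w : Vec d) : ProjTangent (Projectivization.mk ℝ u hu) :=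
  (((‖u‖ ^ 2)⁻¹ • (innerSL ℝ u).toLinearMap).comp
    (Projectivization.mk ℝ u hu).submodule.subtype).smulRight
      ((Projectivization.mk ℝ u hu).submodule.mkQ w)

theorem mkDeriv_apply_self (u : Vec d) (hu : u ≠ 0) (w : Vec d)
    (h : u ∈ (Projectivization.mk ℝ u hu).submodule) :
    mkDeriv u hu w ⟨u, h⟩ = (Projectivization.mk ℝ u hu).submodule.mkQ w := by
  have h0 : ‖u‖ ≠ 0 := norm_ne_zero_iff.mpr hu
  have h1 : (‖u‖ ^ 2)⁻¹ * inner ℝ u u = 1 := by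
    rw [real_inner_self_eq_norm_sq]
    exact inv_mul_cancel₀ (pow_ne_zero 2 h0)
  change ((‖u‖ ^ 2)⁻¹ * inner ℝ u u) • (Projectivization.mk ℝ u hu).submodule.mkQ w = _
  rw [h1, one_smul]

/-- The total space of the tangent bundle of the projective space. -/
structure ProjTangentBundle (d : ℕ) : Type where
  base : Proj d
  vec : ProjTangent base

/-- The usual topology of the tangent bundle: the quotient topology for the differential
`T(ℝ^(d+1) ∖ {0}) → T(Proj d)` of the projection `u ↦ [u]`. -/
instance instTopologicalSpaceProjTangentBundle : TopologicalSpace (ProjTangentBundle d) :=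
  TopologicalSpace.coinduced
    (fun p : {u : Vec d // u ≠ 0} × Vec d =>
      (⟨Projectivization.mk ℝ p.1.1 p.1.2, mkDeriv p.1.1 p.1.2 p.2⟩ : ProjTangentBundle d))
    inferInstance

/-! ### The action of the projective linear group -/

/-- The projective transformation induced by a linear automorphism of `ℝ^(d+1)`. -/
def projMap (g : Vec d ≃ₗ[ℝ] Vec d) : Proj d → Proj d :=
  Projectivization.map g.toLinearMap g.injective

theorem projMap_mk (g : Vec d ≃ₗ[ℝ] Vec d) (u : Vec d) (hu : u ≠ 0) :
    projMap g (Projectivization.mk ℝ u hu) =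
      Projectivization.mk ℝ (g u) ((map_ne_zero_iff g g.injective).mpr hu) := rfl

theorem continuous_projMap (g : Vec d ≃ₗ[ℝ] Vec d) : Continuous (projMap g) := by
  refine continuous_coinduced_dom.mpr ?_
  have hg : Continuous g := g.toLinearMap.continuous_of_finiteDimensional
  have h1 : Continuous (fun u : {u : Vec d // u ≠ 0} =>
      (⟨g u.1, (map_ne_zero_iff g g.injective).mpr u.2⟩ : {u : Vec d // u ≠ 0})) :=
    (hg.comp continuous_subtype_val).subtype_mk _
  exact continuous_coinduced_rng.comp h1

theorem projMap_symm_projMap (g : Vec d ≃ₗ[ℝ] Vec d) (x : Proj d) :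
    projMap g.symm (projMap g x) = x := by
  induction x using Projectivization.ind with
  | h v hv => simp [projMap_mk]

theorem image_projMap (g : Vec d ≃ₗ[ℝ] Vec d) (S : Set (Proj d)) :
    projMap g '' S = projMap g.symm ⁻¹' S := by
  have h1 := projMap_symm_projMap g
  have h2 := projMap_symm_projMap g.symm
  exact congrFun (Set.image_eq_preimage_of_inverse h1 h2) S

theorem projMap_submodule (g : Vec d ≃ₗ[ℝ] Vec d) (x : Proj d) :
    (projMap g x).submodule = x.submodule.map g.toLinearMap := by
  induction x using Projectivization.ind with
  | h v hv => simp [projMap_mk, Projectivization.submodule_mk, Submodule.map_span]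

theorem mem_affineChart_mk (f : Module.Dual ℝ (Vec d)) (u : Vec d) (hu : u ≠ 0) :
    Projectivization.mk ℝ u hu ∈ affineChart f ↔ f u ≠ 0 := by
  obtain ⟨a, ha⟩ := Projectivization.exists_smul_eq_mk_rep ℝ u hu
  have ha' : (a : ℝ) • u = (Projectivization.mk ℝ u hu).rep := ha
  simp [affineChart, ← ha']

theorem chartCoord_mk (f : Module.Dual ℝ (Vec d)) (u : Vec d) (hu : u ≠ 0) :
    chartCoord f (Projectivization.mk ℝ u hu) = (f u)⁻¹ • u := by
  obtain ⟨a, ha⟩ := Projectivization.exists_smul_eq_mk_rep ℝ u hu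
  have ha' : (a : ℝ) • u = (Projectivization.mk ℝ u hu).rep := ha
  have ha0 : (a : ℝ) ≠ 0 := a.ne_zero
  rw [chartCoord, ← ha', map_smul, smul_smul, smul_eq_mul, mul_inv_rev, mul_assoc,
    inv_mul_cancel₀ ha0, mul_one]

theorem chartCoord_projMap (f : Module.Dual ℝ (Vec d)) (g : Vec d ≃ₗ[ℝ] Vec d) (x : Proj d) :
    chartCoord (f ∘ₗ g.symm.toLinearMap) (projMap g x) = g (chartCoord f x) := by
  induction x using Projectivization.ind with
  | h v hv => simp [projMap_mk, chartCoord_mk]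

/-- The image of a properly convex open set by a projective transformation. -/
def ProperlyConvexOpen.map (g : Vec d ≃ₗ[ℝ] Vec d) (Ω : ProperlyConvexOpen d) : ProperlyConvexOpen d where
  carrier := projMap g '' Ω.carrier
  isOpen := by
    rw [image_projMap]
    exact Ω.isOpen.preimage (continuous_projMap g.symm)
  properlyConvex := by
    obtain ⟨f, hf, hs, hc, hb⟩ := Ω.properlyConvex
    have himg : chartCoord (f ∘ₗ g.symm.toLinearMap) '' (projMap g '' Ω.carrier) =
        g.toLinearMap '' (chartCoord f '' Ω.carrier) := by
      simp only [Set.image_image, chartCoord_projMap]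
      rfl
    refine ⟨f ∘ₗ g.symm.toLinearMap, ?_, ?_, ?_, ?_⟩
    · intro h
      apply hf
      ext v
      have := LinearMap.congr_fun h (g v)
      simpa using this
    · rintro _ ⟨x, hx, rfl⟩
      have hx' := hs hx
      induction x using Projectivization.ind with
      | h v hv =>
        rw [projMap_mk, mem_affineChart_mk]
        rw [mem_affineChart_mk] at hx'
        simpa using hx'
    · rw [himg]
      exact hc.linear_image g.toLinearMap
    · rw [himg]
      exact hb.image (LinearMap.toContinuousLinearMap g.toLinearMap)

theorem projMap_mem_map (g : Vec d ≃ₗ[ℝ] Vec d) {Ω : ProperlyConvexOpen d} {x : Proj d} (hx : x ∈ Ω) :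
    projMap g x ∈ Ω.map g :=
  ⟨x, hx, rfl⟩

/-- The differential at `x` of the projective transformation `projMap g`: the linear map
`φ : x → ℝ^(d+1) / x` is sent to `g ∘ φ ∘ g⁻¹ : g x → ℝ^(d+1) / g x`. -/
def projMapDeriv (g : Vec d ≃ₗ[ℝ] Vec d) (x : Proj d) (φ : ProjTangent x) :
    ProjTangent (projMap g x) :=
  (x.submodule.mapQ (projMap g x).submodule g.toLinearMap (by
      rw [projMap_submodule]
      exact Submodule.le_comap_map _ _)) ∘ₗ φ ∘ₗ
    (g.symm.toLinearMap.restrict (p := (projMap g x).submodule) (q := x.submodule) (by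
      intro z hz
      rw [projMap_submodule] at hz
      obtain ⟨w, hw, rfl⟩ := hz
      simpa using hw))

/-! ### Natural projective metrics -/

/-- A projective metric: a norm on the tangent space at `x`, for all `Ω` in `X` and `x` in `Ω`. -/
structure ProjectiveMetric (d : ℕ) : Type where
  norm : ∀ (Ω : ProperlyConvexOpen d) (x : Proj d), x ∈ Ω → Seminorm ℝ (ProjTangent x)
  definite : ∀ (Ω : ProperlyConvexOpen d) (x : Proj d) (hx : x ∈ Ω) (φ : ProjTangent x),
    norm Ω x hx φ = 0 → φ = 0

/-- The triples `(Ω, x, φ)` with `x` in `Ω` and `φ` a tangent vector at `x`, with the topology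
induced by that of the product of `X` and the tangent bundle. -/
abbrev PointedTangent (d : ℕ) : Type :=
  {p : ProperlyConvexOpen d × ProjTangentBundle d // p.2.base ∈ p.1}

/-- A projective metric is natural when it is continuous and invariant under all projective
transformations. -/
structure ProjectiveMetric.IsNatural (F : ProjectiveMetric d) : Prop where
  continuous : Continuous (fun p : PointedTangent d =>
    F.norm p.1.1 p.1.2.base p.2 p.1.2.vec)
  invariant : ∀ (g : Vec d ≃ₗ[ℝ] Vec d) (Ω : ProperlyConvexOpen d) (x : Proj d) (hx : x ∈ Ω)
    (φ : ProjTangent x),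
    F.norm (Ω.map g) (projMap g x) (projMap_mem_map g hx) (projMapDeriv g x φ) = F.norm Ω x hx φ

/-- A `C¹` path in `Ω` from `x` to `y`, given by a `C¹` lift to `ℝ^(d+1) ∖ {0}` (every `C¹` path
in `Ω` has one, since `Ω` lies in an affine chart). -/
structure C1Path (Ω : ProperlyConvexOpen d) (x y : Proj d) : Type where
  lift : ℝ → Vec d
  contDiffOn : ContDiffOn ℝ 1 lift (Icc 0 1)
  ne_zero : ∀ t : unitInterval, lift t ≠ 0
  mem : ∀ t : unitInterval, Projectivization.mk ℝ (lift t) (ne_zero t) ∈ Ω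
  source : Projectivization.mk ℝ (lift (0 : unitInterval)) (ne_zero 0) = x
  target : Projectivization.mk ℝ (lift (1 : unitInterval)) (ne_zero 1) = y

/-- The length of a path for a projective metric: the integral of the norm of its velocity. -/
def ProjectiveMetric.length (F : ProjectiveMetric d) {Ω : ProperlyConvexOpen d} {x y : Proj d}
    (γ : C1Path Ω x y) : ℝ :=
  ∫ t : unitInterval, F.norm Ω (Projectivization.mk ℝ (γ.lift t) (γ.ne_zero t)) (γ.mem t)
    (mkDeriv (γ.lift t) (γ.ne_zero t) (derivWithin γ.lift (Icc 0 1) t))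

/-- The distance that comes from a projective metric: the infimum of the lengths of paths. -/
def ProjectiveMetric.dist (F : ProjectiveMetric d) (Ω : ProperlyConvexOpen d) (x y : Proj d) : ℝ :=
  ⨅ γ : C1Path Ω x y, F.length γ

/-! ### The Hilbert distance and the Hilbert norm -/

/-- The point where the ray from `a` in the direction `v` leaves the bounded set `C`. -/
def exitPoint (C : Set (Vec d)) (a v : Vec d) : Vec d :=
  a + sSup {t : ℝ | 0 ≤ t ∧ a + t • v ∈ C} • v

/-- The Hilbert distance of a bounded convex set `C` of an affine chart:
`d(a, b) = ½ log (|p b| |q a| / (|p a| |q b|))`, where `p`, `q` are the points where the line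
`(ab)` meets the boundary of `C`, in the order `p, a, b, q`; and `d(a, a) = 0`. -/
def affineHilbertDist (C : Set (Vec d)) (a b : Vec d) : ℝ :=
  open Classical in
  if a = b then 0
  else
    let p := exitPoint C a (a - b)
    let q := exitPoint C a (b - a)
    1 / 2 * Real.log (‖p - b‖ * ‖q - a‖ / (‖p - a‖ * ‖q - b‖))

/-- The Finsler norm of the Hilbert distance of a bounded convex set `C` of an affine chart:
`F(a, v) = (|v| / 2) (1 / |a p⁻| + 1 / |a p⁺|)`, where `p⁻`, `p⁺` are the points where the line
through `a` directed by `v` meets the boundary of `C`. -/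
def affineHilbertNorm (C : Set (Vec d)) (a v : Vec d) : ℝ :=
  ‖v‖ / 2 * (1 / ‖exitPoint C a (-v) - a‖ + 1 / ‖exitPoint C a v - a‖)

/-- A linear form whose affine chart contains `Ω` as a bounded convex set. -/
def ProperlyConvexOpen.chart (Ω : ProperlyConvexOpen d) : Module.Dual ℝ (Vec d) :=
  Ω.properlyConvex.choose

theorem chartCoord_mem (f : Module.Dual ℝ (Vec d)) (x : Proj d) : chartCoord f x ∈ x.submodule := by
  rw [Projectivization.submodule_eq]
  exact Submodule.smul_mem _ _ (Submodule.mem_span_singleton_self _)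

/-- The differential at `x` of the chart `chartCoord f`, with values in `ker f`. If `a` is the
representative of `x` with `f a = 1`, and `w` represents `φ a`, it sends `φ` to `w - f w • a`,
which does not depend on `w`. -/
def chartCoordDeriv (f : Module.Dual ℝ (Vec d)) (x : Proj d) (φ : ProjTangent x) : Vec d :=
  let w := Function.surjInv x.submodule.mkQ_surjective (φ ⟨chartCoord f x, chartCoord_mem f x⟩)
  w - f w • chartCoord f x

/-- The Hilbert distance of `Ω`, computed in an affine chart in which `Ω` is bounded. As the
cross-ratio is a projective invariant, the choice of the chart does not matter. -/
def hilbertDist (Ω : ProperlyConvexOpen d) (x y : Proj d) : ℝ :=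
  affineHilbertDist (chartCoord Ω.chart '' Ω.carrier) (chartCoord Ω.chart x)
    (chartCoord Ω.chart y)

/-- The Hilbert norm on the tangent space of `Ω` at `x`, that is, the Finsler metric of the
Hilbert distance, computed in an affine chart in which `Ω` is bounded. -/
def hilbertNorm (Ω : ProperlyConvexOpen d) (x : Proj d) (φ : ProjTangent x) : ℝ :=
  affineHilbertNorm (chartCoord Ω.chart '' Ω.carrier) (chartCoord Ω.chart x)
    (chartCoordDeriv Ω.chart x φ)

end HilbertGeometry

end

open HilbertGeometry

namespace HilbertGeometry

variable {d : ℕ}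

/-! The projective group acts cocompactly on pairs `(Ω, x)` (Benzécri), and a natural metric is
invariant and continuous. Its values are therefore controlled by those on a compact family of
normalized pairs, where a positive continuous function on unit tangent vectors has positive bounds.

The normalization lives in the dual cone. Fix a lift `a` of `x` and consider the forms that are
nonnegative on the cone over `Ω` and equal to `1` at `a`: they form a compact set, `dualSlice`.
Choose `d + 1` of them spanning a simplex of maximal volume. By Cramer's rule every other form in
the slice has coefficients in `[-1, 1]` on them (`IsSharpCone.exists_maximal_simplex`). Taken as
coordinates, they send `a` to `ones d` and the cone into the positive orthant, and the image
contains a ball around `ones d` whose radius depends on `d` only (`exists_map_eq_normalSet`).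

The Hilbert norm is half the width of the dual slice in the direction of the vector. In these
coordinates it is thus comparable with the Euclidean norm, with constants depending on `d`, and so
with `F` (`ProjectiveMetric.IsNatural.exists_bounds`).

For distances, the Hilbert norm integrates along a chart segment to exactly the Hilbert distance
(`mul_length_segmentPath_le`). For an arbitrary path, two supporting forms at the ends of the chord
give a function `½ log (n' / n)` whose derivative is at most the Hilbert norm and whose total
variation is the Hilbert distance (`hilbertDist_le_mul_length`). Two natural metrics are then
compared through the Hilbert distance. -/

/-! ### Open convex cones and their duals -/

/-- An open convex cone on which the linear form `f` is positive, with bounded sections. -/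
structure IsSharpCone (K : Set (Vec d)) (f : Module.Dual ℝ (Vec d)) : Prop where
  isOpen : IsOpen K
  convex : Convex ℝ K
  smul_mem : ∀ {c : ℝ} {y : Vec d}, 0 < c → y ∈ K → c • y ∈ K
  pos : ∀ {y : Vec d}, y ∈ K → 0 < f y
  bounded : ∃ R : ℝ, ∀ y ∈ K, ‖y‖ ≤ R * f y

/-- The forms (given as inner products) that are nonnegative on `K` and take the value `1`
at `u`. -/
def dualSlice (K : Set (Vec d)) (u : Vec d) : Set (Vec d) :=
  {n | (∀ y ∈ K, 0 ≤ inner ℝ n y) ∧ inner ℝ n u = 1}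

theorem exists_pos_forall_add_smul_mem {K : Set (Vec d)} (hK : IsOpen K) {y : Vec d}
    (hy : y ∈ K) (v : Vec d) : ∃ ε : ℝ, 0 < ε ∧ y + ε • v ∈ K := by
  have hc : Continuous (fun t : ℝ => y + t • v) := by fun_prop
  have h0 : (fun t : ℝ => y + t • v) ⁻¹' K ∈ 𝓝 (0 : ℝ) :=
    (hK.preimage hc).mem_nhds (by simpa using hy)
  obtain ⟨ε, hε, h⟩ := Metric.mem_nhds_iff.mp h0
  refine ⟨ε / 2, by positivity, h ?_⟩
  rw [Metric.mem_ball, dist_zero_right, Real.norm_of_nonneg (by positivity)]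
  linarith

/-- Since `K` is open, `y` can be moved a little in the direction `-u`, which strictly lowers the
value of `n`. -/
theorem inner_pos_of_mem_dualSlice {K : Set (Vec d)} (hK : IsOpen K) {u n y : Vec d}
    (hn : n ∈ dualSlice K u) (hy : y ∈ K) : 0 < inner ℝ n y := by
  obtain ⟨ε, hε, h⟩ := exists_pos_forall_add_smul_mem hK hy (-u)
  have h1 := hn.1 _ h
  rw [inner_add_right, inner_smul_right, inner_neg_right, hn.2] at h1
  linarith

theorem smul_mem_dualSlice {K : Set (Vec d)} {u n : Vec d} (hn : ∀ y ∈ K, 0 ≤ inner ℝ n y)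
    (hu : 0 < inner ℝ n u) : (inner ℝ n u)⁻¹ • n ∈ dualSlice K u := by
  refine ⟨fun y hy => ?_, ?_⟩
  · rw [real_inner_smul_left]
    exact mul_nonneg (inv_nonneg.mpr hu.le) (hn y hy)
  · rw [real_inner_smul_left, inv_mul_cancel₀ hu.ne']

/-- Separation of a point from an open convex cone. -/
theorem IsSharpCone.exists_mem_dualSlice_inner_nonpos {K : Set (Vec d)}
    {f : Module.Dual ℝ (Vec d)} (hK : IsSharpCone K f) {u y : Vec d} (hu : u ∈ K) (hy : y ∉ K) :
    ∃ n ∈ dualSlice K u, inner ℝ n y ≤ 0 := by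
  obtain ⟨l, hl⟩ := geometric_hahn_banach_open_point hK.convex hK.isOpen hy
  set m : Vec d := -(InnerProductSpace.toDual ℝ (Vec d)).symm l with hm
  have hmi : ∀ z, inner ℝ m z = -l z := fun z => by
    rw [hm, inner_neg_left, InnerProductSpace.toDual_symm_apply]
  -- Otherwise scaling `z` would make `l` unbounded on the cone, yet it stays below `l y`.
  have h0 : ∀ z ∈ K, l z ≤ 0 := by
    intro z hz
    by_contra! hlz
    have h1 := hl _ (hK.smul_mem (c := (|l y| + 1) / l z) (by positivity) hz)
    rw [map_smul, smul_eq_mul, div_mul_cancel₀ _ hlz.ne'] at h1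
    linarith [le_abs_self (l y)]
  have hly : 0 ≤ l y := by
    by_contra! hly
    have hlu : l u < 0 := (hl u hu).trans hly
    have h1 := hl _ (hK.smul_mem (c := l y / l u) (div_pos_of_neg_of_neg hly hlu) hu)
    rw [map_smul, smul_eq_mul, div_mul_cancel₀ _ hlu.ne] at h1
    exact lt_irrefl _ h1
  have hlu : 0 < inner ℝ m u := by
    rw [hmi]
    rcases (h0 u hu).lt_or_eq with h | h
    · linarith
    -- If `l u = 0`, then `l y > 0`, and a small step from `u` towards `y` stays in `K` where `l`
    -- would be positive.
    · obtain ⟨ε, hε, h2⟩ := exists_pos_forall_add_smul_mem hK.isOpen hu (y - u)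
      have h3 := hl u hu
      have h4 := h0 _ h2
      rw [map_add, map_smul, map_sub, h, smul_eq_mul] at h4
      nlinarith
  refine ⟨_, smul_mem_dualSlice (n := m) (u := u) (fun z hz => ?_) hlu, ?_⟩
  · rw [hmi]; linarith [h0 z hz]
  · rw [real_inner_smul_left, hmi y]
    exact mul_nonpos_of_nonneg_of_nonpos (inv_nonneg.mpr hlu.le) (by linarith)

/-- If the `ε`-ball at `u` lies in `K`, testing `n` at distance `ε / 2` from `u` in the direction
`-n` gives `‖n‖ ≤ 2 / ε`. -/
theorem isCompact_dualSlice {K : Set (Vec d)} (hK : IsOpen K) {u : Vec d} (hu : u ∈ K) :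
    IsCompact (dualSlice K u) := by
  refine Metric.isCompact_of_isClosed_isBounded ?_ ?_
  · have : dualSlice K u = (⋂ y ∈ K, {n | 0 ≤ inner ℝ n y}) ∩ {n | inner ℝ n u = 1} := by
      ext n; simp [dualSlice]
    rw [this]
    refine IsClosed.inter (isClosed_biInter fun y _ => ?_) ?_
    · exact isClosed_le continuous_const (by fun_prop)
    · exact isClosed_eq (by fun_prop) continuous_const
  · obtain ⟨ε, hε, hb⟩ := Metric.isOpen_iff.mp hK u hu
    refine isBounded_iff_forall_norm_le.mpr ⟨2 / ε, fun n hn => ?_⟩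
    rcases eq_or_ne n 0 with rfl | hn0
    · simp; positivity
    have hpos : 0 < ‖n‖ := norm_pos_iff.mpr hn0
    have hmem : u - (ε / 2 * ‖n‖⁻¹) • n ∈ K := by
      apply hb
      rw [mem_ball_iff_norm, sub_sub_cancel_left, norm_neg, norm_smul, Real.norm_of_nonneg
        (by positivity), mul_assoc, inv_mul_cancel₀ hpos.ne']
      linarith
    have h1 := hn.1 _ hmem
    rw [inner_sub_right, inner_smul_right, hn.2, real_inner_self_eq_norm_sq] at h1
    have h2 : ε / 2 * ‖n‖⁻¹ * ‖n‖ ^ 2 = ε / 2 * ‖n‖ := by field_simp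
    rw [h2] at h1
    rw [le_div_iff₀ hε]
    linarith

/-- Because `‖y‖ ≤ R * f y` on `K`, the form `f` is interior to the dual cone: all nearby forms are
positive on `K`, hence multiples of elements of the slice. -/
theorem IsSharpCone.span_dualSlice {K : Set (Vec d)} {f : Module.Dual ℝ (Vec d)}
    (hK : IsSharpCone K f) {u : Vec d} (hu : u ∈ K) :
    Submodule.span ℝ (dualSlice K u) = ⊤ := by
  obtain ⟨R, hR⟩ := hK.bounded
  set m : Vec d := (InnerProductSpace.toDual ℝ (Vec d)).symm f.toContinuousLinearMap with hm
  have hmi : ∀ z, inner ℝ m z = f z := fun z => by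
    rw [hm, InnerProductSpace.toDual_symm_apply]; rfl
  have hR0 : 0 < |R| + 1 := by positivity
  refine Submodule.eq_top_of_nonempty_interior' _ ⟨m, ?_⟩
  rw [mem_interior_iff_mem_nhds]
  refine Filter.mem_of_superset (Metric.ball_mem_nhds m (inv_pos.mpr hR0)) ?_
  intro n hn
  rw [mem_ball_iff_norm] at hn
  have hpos : ∀ y ∈ K, 0 < inner ℝ n y := by
    intro y hy
    have h1 : inner ℝ n y = f y + inner ℝ (n - m) y := by
      rw [inner_sub_left, hmi]; ring
    have h2 := abs_real_inner_le_norm (n - m) y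
    have h3 : ‖y‖ ≤ (|R| + 1) * f y :=
      (hR y hy).trans (by nlinarith [le_abs_self R, hK.pos hy])
    have h4 : ‖n - m‖ * (|R| + 1) < 1 := by
      rwa [← lt_div_iff₀ hR0, one_div]
    have h5 : ‖n - m‖ * ‖y‖ ≤ ‖n - m‖ * (|R| + 1) * f y := by
      rw [mul_assoc]; gcongr
    have h6 := hK.pos hy
    rw [h1]
    have := neg_abs_le (inner ℝ (n - m) y)
    nlinarith
  have h1 := Submodule.subset_span (R := ℝ)
    (smul_mem_dualSlice (fun y hy => (hpos y hy).le) (hpos u hu))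
  have h2 := Submodule.smul_mem _ (inner ℝ n u) h1
  rwa [smul_smul, mul_inv_cancel₀ (hpos u hu).ne', one_smul] at h2

theorem IsSharpCone.exists_det_ne_zero {K : Set (Vec d)} {f : Module.Dual ℝ (Vec d)}
    (hK : IsSharpCone K f) {u : Vec d} (hu : u ∈ K) :
    ∃ n : Fin (d + 1) → Vec d, (∀ i, n i ∈ dualSlice K u) ∧
      (Matrix.of fun i j => n i j).det ≠ 0 := by
  obtain ⟨b, hbs, hbspan, hbli⟩ := exists_linearIndependent ℝ (dualSlice K u)
  rw [hK.span_dualSlice hu] at hbspan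
  let B : Module.Basis b ℝ (Vec d) := Module.Basis.mk hbli (by rw [Subtype.range_coe]; exact hbspan.ge)
  let e : Fin (d + 1) ≃ b := (EuclideanSpace.basisFun (Fin (d + 1)) ℝ).toBasis.indexEquiv B
  refine ⟨fun i => (e i : Vec d), fun i => hbs (e i).2, ?_⟩
  have hli : LinearIndependent ℝ (fun i => (WithLp.linearEquiv 2 ℝ (Fin (d + 1) → ℝ)) (e i : Vec d)) := by
    have := (hbli.comp e e.injective).map' (WithLp.linearEquiv 2 ℝ (Fin (d + 1) → ℝ)).toLinearMap
      (LinearEquiv.ker _)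
    exact this
  have h2 : IsUnit (Matrix.of fun i j => (e i : Vec d) j) :=
    Matrix.linearIndependent_rows_iff_isUnit.mp hli
  exact ((Matrix.isUnit_iff_isUnit_det _).mp h2).ne_zero

/-- Cramer's rule: a vector as a combination of the rows of a matrix. -/
theorem det_smul_eq_sum (n : Fin (d + 1) → Vec d) (m : Vec d) :
    (Matrix.of fun i j => n i j).det • m =
      ∑ i, (Matrix.of fun k j => Function.update n i m k j).det • n i := by
  have h := Matrix.mulVec_cramer (Matrix.of fun i j => n i j).transpose (fun j => m j)
  ext j
  have hj := congrFun h j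
  rw [Matrix.det_transpose] at hj
  simp only [Pi.smul_apply] at hj
  rw [PiLp.smul_apply, ← hj, Matrix.mulVec, dotProduct]
  simp only [WithLp.ofLp_sum, Finset.sum_apply, PiLp.smul_apply, smul_eq_mul]
  refine Finset.sum_congr rfl fun i _ => ?_
  rw [Matrix.cramer_transpose_apply, Matrix.transpose_apply, Matrix.of_apply, mul_comm]
  congr 2
  ext k l
  rcases eq_or_ne k i with rfl | hki
  · simp
  · simp [Matrix.updateRow_ne hki, Function.update_of_ne hki]

/-- A simplex of maximal volume in the dual section. -/
theorem IsSharpCone.exists_maximal_simplex {K : Set (Vec d)} {f : Module.Dual ℝ (Vec d)}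
    (hK : IsSharpCone K f) {u : Vec d} (hu : u ∈ K) :
    ∃ n : Fin (d + 1) → Vec d, (∀ i, n i ∈ dualSlice K u) ∧
      (∀ m : Vec d, ∃ c : Fin (d + 1) → ℝ, m = ∑ i, c i • n i) ∧
      (∀ m ∈ dualSlice K u, ∃ c : Fin (d + 1) → ℝ, (∀ i, |c i| ≤ 1) ∧ m = ∑ i, c i • n i) := by
  obtain ⟨n₀, hn₀, hdet₀⟩ := hK.exists_det_ne_zero hu
  have hcpt : IsCompact (Set.univ.pi fun _ : Fin (d + 1) => dualSlice K u) :=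
    isCompact_univ_pi fun _ => isCompact_dualSlice hK.isOpen hu
  have hcont : Continuous fun n : Fin (d + 1) → Vec d => |(Matrix.of fun i j => n i j).det| := by
    refine (Continuous.matrix_det ?_).abs
    refine continuous_matrix fun i j => ?_
    simp only [Matrix.of_apply]
    fun_prop
  obtain ⟨n, hn, hmax⟩ := hcpt.exists_isMaxOn ⟨n₀, fun i _ => hn₀ i⟩ hcont.continuousOn
  have hdet : (Matrix.of fun i j => n i j).det ≠ 0 := by
    have h1 : |(Matrix.of fun i j => n₀ i j).det| ≤ |(Matrix.of fun i j => n i j).det| :=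
      hmax (fun i _ => hn₀ i : n₀ ∈ _)
    exact abs_pos.mp ((abs_pos.mpr hdet₀).trans_le h1)
  have key : ∀ m : Vec d, m = ∑ i, ((Matrix.of fun i j => n i j).det⁻¹ *
      (Matrix.of fun k j => Function.update n i m k j).det) • n i := by
    intro m
    simp only [mul_smul]
    rw [← Finset.smul_sum, ← det_smul_eq_sum, smul_smul, inv_mul_cancel₀ hdet, one_smul]
  refine ⟨n, fun i => hn i trivial, fun m => ⟨_, key m⟩, fun m hm => ⟨_, fun i => ?_, key m⟩⟩
  -- The Cramer coefficient is a quotient of two volumes; replacing a vertex by another point of the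
  -- slice cannot increase the maximal one.
  have h1 : |(Matrix.of fun k j => Function.update n i m k j).det| ≤
      |(Matrix.of fun i j => n i j).det| := by
    refine hmax (a := Function.update n i m) fun k _ => ?_
    rw [Function.update_apply]
    split_ifs
    · exact hm
    · exact hn k trivial
  rw [abs_mul, abs_inv, inv_mul_eq_div]
  exact div_le_one_of_le₀ h1 (abs_nonneg _)

/-! ### Exit times -/

/-- The section `f = 1` of a cone. -/
def coneSection (K : Set (Vec d)) (f : Module.Dual ℝ (Vec d)) : Set (Vec d) :=
  {y | y ∈ K ∧ f y = 1}

/-- The time at which the ray from `a` in the direction `v` leaves `S`. -/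
noncomputable def exitTime (S : Set (Vec d)) (a v : Vec d) : ℝ :=
  sSup {t : ℝ | 0 ≤ t ∧ a + t • v ∈ S}

theorem exitPoint_eq (S : Set (Vec d)) (a v : Vec d) :
    exitPoint S a v = a + exitTime S a v • v := rfl

/-- All times are allowed, so the supremum takes its default value `0`. Its inverse is again `0`,
and the formulas in inverse exit times remain valid at the zero vector. -/
theorem exitTime_zero (S : Set (Vec d)) {a : Vec d} (ha : a ∈ S) : exitTime S a 0 = 0 := by
  refine Real.sSup_of_not_bddAbove ?_
  rintro ⟨B, hB⟩
  have := hB (show |B| + 1 ∈ {t : ℝ | 0 ≤ t ∧ a + t • (0 : Vec d) ∈ S} from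
    ⟨by positivity, by simpa using ha⟩)
  linarith [le_abs_self B]

namespace IsSharpCone

variable {K : Set (Vec d)} {f : Module.Dual ℝ (Vec d)} (hK : IsSharpCone K f) {a v : Vec d}

include hK

theorem bddAbove_exitTime (hv : v ≠ 0) :
    BddAbove {t : ℝ | 0 ≤ t ∧ a + t • v ∈ coneSection K f} := by
  obtain ⟨R, hR⟩ := hK.bounded
  have hv0 : 0 < ‖v‖ := norm_pos_iff.mpr hv
  refine ⟨(R + ‖a‖) / ‖v‖, fun t ht => ?_⟩
  have h1 := hR _ ht.2.1
  rw [ht.2.2, mul_one] at h1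
  rw [le_div_iff₀ hv0]
  have h2 : ‖t • v‖ ≤ ‖a + t • v‖ + ‖a‖ := by
    have := norm_sub_le (a + t • v) a
    rwa [add_sub_cancel_left] at this
  rw [norm_smul, Real.norm_of_nonneg ht.1] at h2
  linarith

/-- The admissible times form a half-open interval from `0`: convexity fills it and openness
excludes its right end. -/
theorem add_smul_mem_coneSection_iff (ha : a ∈ coneSection K f) (hv : v ≠ 0) (hfv : f v = 0)
    {t : ℝ} (ht : 0 ≤ t) : a + t • v ∈ coneSection K f ↔ t < exitTime (coneSection K f) a v := by
  have hf : ∀ s : ℝ, f (a + s • v) = 1 := fun s => by simp [ha.2, hfv]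
  constructor
  · intro h
    obtain ⟨ε, hε, h2⟩ := exists_pos_forall_add_smul_mem hK.isOpen h.1 v
    rw [add_assoc, ← add_smul] at h2
    have := le_csSup (hK.bddAbove_exitTime hv)
      (show t + ε ∈ {t : ℝ | 0 ≤ t ∧ a + t • v ∈ coneSection K f} from
        ⟨by positivity, h2, hf _⟩)
    exact (lt_add_of_pos_right t hε).trans_le this
  · intro h
    obtain ⟨s, hs, hts⟩ := exists_lt_of_lt_csSup
      (show {t : ℝ | 0 ≤ t ∧ a + t • v ∈ coneSection K f}.Nonempty from
        ⟨0, le_rfl, by simpa using ha⟩) h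
    refine ⟨?_, hf t⟩
    have hs0 : 0 < s := ht.trans_lt hts
    have := hK.convex ha.1 hs.2.1 (a := 1 - t / s) (b := t / s)
      (by rw [sub_nonneg, div_le_one hs0]; exact hts.le) (by positivity) (by ring)
    convert this using 1
    rw [smul_add, smul_smul, div_mul_cancel₀ _ hs0.ne', ← add_assoc, ← add_smul]
    simp

theorem exitTime_pos (ha : a ∈ coneSection K f) (hv : v ≠ 0) (hfv : f v = 0) :
    0 < exitTime (coneSection K f) a v :=
  (hK.add_smul_mem_coneSection_iff ha hv hfv le_rfl).mp (by simpa using ha)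

theorem exitTime_add_smul (ha : a ∈ coneSection K f) (hv : v ≠ 0) (hfv : f v = 0)
    {s : ℝ} (hs : 0 ≤ s) (has : a + s • v ∈ coneSection K f) :
    exitTime (coneSection K f) (a + s • v) v = exitTime (coneSection K f) a v - s := by
  have h1 := (hK.add_smul_mem_coneSection_iff ha hv hfv hs).mp has
  have : {t : ℝ | 0 ≤ t ∧ a + s • v + t • v ∈ coneSection K f} =
      Ico 0 (exitTime (coneSection K f) a v - s) := by
    ext t
    simp only [mem_ofPred_eq, mem_Ico]
    refine and_congr_right fun ht => ?_
    rw [add_assoc, ← add_smul, hK.add_smul_mem_coneSection_iff ha hv hfv (by positivity)]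
    constructor <;> intro h <;> linarith
  rw [exitTime, this, csSup_Ico (by linarith)]

theorem exitTime_add_smul_neg (ha : a ∈ coneSection K f) (hv : v ≠ 0) (hfv : f v = 0)
    {s : ℝ} (hs : 0 ≤ s) (has : a + s • v ∈ coneSection K f) :
    exitTime (coneSection K f) (a + s • v) (-v) = exitTime (coneSection K f) a (-v) + s := by
  have h0 := hK.exitTime_pos ha (neg_ne_zero.mpr hv) (by simp [hfv])
  have h1 := (hK.add_smul_mem_coneSection_iff ha hv hfv hs).mp has
  have : {t : ℝ | 0 ≤ t ∧ a + s • v + t • -v ∈ coneSection K f} =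
      Ico 0 (exitTime (coneSection K f) a (-v) + s) := by
    ext t
    simp only [mem_ofPred_eq, mem_Ico]
    refine and_congr_right fun ht => ?_
    rw [add_assoc, smul_neg, ← sub_eq_add_neg, ← sub_smul]
    rcases le_total t s with hts | hts
    · rw [hK.add_smul_mem_coneSection_iff ha hv hfv (by linarith)]
      constructor <;> intro h <;> linarith
    · have : a + (s - t) • v = a + (t - s) • -v := by rw [smul_neg, ← neg_smul, neg_sub]
      rw [this, hK.add_smul_mem_coneSection_iff ha (neg_ne_zero.mpr hv) (by simp [hfv])
        (by linarith)]
      constructor <;> intro h <;> linarith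
  rw [exitTime, this, csSup_Ico (by linarith)]

/-- Nonnegativity of `n` along the ray reads `1 + t * inner ℝ n v ≥ 0`. With the next lemma, the
inverse exit time is the maximum of `-inner ℝ n v` over the dual slice. -/
theorem neg_inner_le_inv_exitTime (ha : a ∈ coneSection K f) (hfv : f v = 0) {n : Vec d}
    (hn : n ∈ dualSlice K a) : -inner ℝ n v ≤ (exitTime (coneSection K f) a v)⁻¹ := by
  rcases eq_or_ne v 0 with rfl | hv
  · rw [exitTime_zero _ ha]; simp
  have hT := hK.exitTime_pos ha hv hfv
  by_contra! h
  have h2 : exitTime (coneSection K f) a v ≤ (-inner ℝ n v)⁻¹ := by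
    refine csSup_le ⟨0, le_rfl, by simpa using ha⟩ fun t ht => ?_
    have h3 := hn.1 _ ht.2.1
    rw [inner_add_right, inner_smul_right, hn.2] at h3
    rw [← one_div, le_div_iff₀ ((inv_pos.mpr hT).trans h)]
    linarith
  have h3 := inv_anti₀ hT h2
  rw [inv_inv] at h3
  linarith

/-- The maximum is reached by a form separating the exit point, which is not in `K`, from `K`. -/
theorem exists_neg_inner_eq_inv_exitTime (ha : a ∈ coneSection K f) (hfv : f v = 0) :
    ∃ n ∈ dualSlice K a, -inner ℝ n v = (exitTime (coneSection K f) a v)⁻¹ := by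
  rcases eq_or_ne v 0 with rfl | hv
  · obtain ⟨n, hn, -⟩ := hK.exists_mem_dualSlice_inner_nonpos ha.1 (y := 0)
      (fun h => by simpa using hK.pos h)
    exact ⟨n, hn, by rw [exitTime_zero _ ha]; simp⟩
  have hT := hK.exitTime_pos ha hv hfv
  obtain ⟨n, hn, hn0⟩ := hK.exists_mem_dualSlice_inner_nonpos ha.1
    (y := a + exitTime (coneSection K f) a v • v) (fun h => by
      have h2 := (hK.add_smul_mem_coneSection_iff ha hv hfv hT.le).mp
        ⟨h, by simp [ha.2, hfv]⟩
      exact lt_irrefl _ h2)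
  refine ⟨n, hn, le_antisymm (hK.neg_inner_le_inv_exitTime ha hfv hn) ?_⟩
  rw [inner_add_right, inner_smul_right, hn.2] at hn0
  rw [← one_div, div_le_iff₀ hT]
  linarith

theorem affineHilbertNorm_eq (ha : a ∈ coneSection K f) (hfv : f v = 0) :
    affineHilbertNorm (coneSection K f) a v = 1 / 2 *
      ((exitTime (coneSection K f) a (-v))⁻¹ + (exitTime (coneSection K f) a v)⁻¹) := by
  rcases eq_or_ne v 0 with rfl | hv
  · rw [affineHilbertNorm, neg_zero, exitTime_zero _ ha]; simp
  have hT := hK.exitTime_pos ha hv hfv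
  have hT' := hK.exitTime_pos ha (neg_ne_zero.mpr hv) (by simp [hfv])
  have hv0 : ‖v‖ ≠ 0 := norm_ne_zero_iff.mpr hv
  rw [affineHilbertNorm, exitPoint_eq, exitPoint_eq, add_sub_cancel_left, add_sub_cancel_left,
    norm_smul, norm_smul, norm_neg, Real.norm_of_nonneg hT.le, Real.norm_of_nonneg hT'.le]
  field_simp

/-- Together with `exists_affineHilbertNorm_eq`, this makes the Hilbert norm half the width of the
dual slice in the direction `v`, without reference to boundary points. -/
theorem le_affineHilbertNorm (ha : a ∈ coneSection K f) (hfv : f v = 0) {n n' : Vec d}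
    (hn : n ∈ dualSlice K a) (hn' : n' ∈ dualSlice K a) :
    1 / 2 * (inner ℝ n' v - inner ℝ n v) ≤ affineHilbertNorm (coneSection K f) a v := by
  rw [hK.affineHilbertNorm_eq ha hfv]
  have h1 := hK.neg_inner_le_inv_exitTime ha hfv hn
  have h2 := hK.neg_inner_le_inv_exitTime (v := -v) ha (by simp [hfv]) hn'
  rw [inner_neg_right, neg_neg] at h2
  linarith

theorem exists_affineHilbertNorm_eq (ha : a ∈ coneSection K f) (hfv : f v = 0) :
    ∃ n ∈ dualSlice K a, ∃ n' ∈ dualSlice K a,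
      affineHilbertNorm (coneSection K f) a v = 1 / 2 * (inner ℝ n' v - inner ℝ n v) := by
  obtain ⟨n, hn, h1⟩ := hK.exists_neg_inner_eq_inv_exitTime ha hfv
  obtain ⟨n', hn', h2⟩ := hK.exists_neg_inner_eq_inv_exitTime (v := -v) ha (by simp [hfv])
  rw [inner_neg_right, neg_neg] at h2
  exact ⟨n, hn, n', hn', by rw [hK.affineHilbertNorm_eq ha hfv, h2, ← h1]; ring⟩

/-- In the parameter `t` of `a + t • (b - a)`, the points `p, a, b, q` are at `-T', 0, 1, T`; the
length of `b - a` cancels in the cross-ratio. -/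
theorem affineHilbertDist_eq {b : Vec d} (ha : a ∈ coneSection K f) (hb : b ∈ coneSection K f)
    (hab : a ≠ b) :
    affineHilbertDist (coneSection K f) a b = 1 / 2 *
      (Real.log (exitTime (coneSection K f) a (-(b - a)) + 1) -
        Real.log (exitTime (coneSection K f) a (-(b - a))) +
        (Real.log (exitTime (coneSection K f) a (b - a)) -
          Real.log (exitTime (coneSection K f) a (b - a) - 1))) := by
  have hv : b - a ≠ 0 := sub_ne_zero.mpr hab.symm
  have hfv : f (b - a) = 0 := by simp [ha.2, hb.2]
  have hT := hK.exitTime_pos ha hv hfv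
  have hT' := hK.exitTime_pos ha (neg_ne_zero.mpr hv) (by simp [ha.2, hb.2])
  have hT1 := (hK.add_smul_mem_coneSection_iff ha hv hfv zero_le_one).mp (by simpa using hb)
  have hv0 : ‖b - a‖ ≠ 0 := norm_ne_zero_iff.mpr hv
  rw [affineHilbertDist, if_neg hab]
  simp only [exitPoint_eq]
  rw [← neg_sub b a]
  set T := exitTime (coneSection K f) a (b - a)
  set T' := exitTime (coneSection K f) a (-(b - a))
  have e1 : a + T' • -(b - a) - b = (T' + 1) • -(b - a) := by module
  have e2 : a + T • (b - a) - b = (T - 1) • (b - a) := by module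
  have h1 : 0 < T - 1 := by linarith
  rw [e1, e2, add_sub_cancel_left, add_sub_cancel_left, norm_smul, norm_smul, norm_smul,
    norm_smul, norm_neg, Real.norm_of_nonneg hT.le, Real.norm_of_nonneg hT'.le,
    Real.norm_of_nonneg h1.le, Real.norm_of_nonneg (by linarith : 0 ≤ T' + 1),
    ← Real.log_div (by linarith) hT'.ne', ← Real.log_div hT.ne' h1.ne',
    ← Real.log_mul (by positivity) (by positivity)]
  congr 2
  field_simp

/-- The forms supporting the cone at `q` and `p` take the values `1 - 1 / T` and `1 + 1 / T'` at
`b`. This logarithmic form of the distance can be differentiated along any path. -/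
theorem exists_affineHilbertDist_eq {b : Vec d} (ha : a ∈ coneSection K f)
    (hb : b ∈ coneSection K f) :
    ∃ n ∈ dualSlice K a, ∃ n' ∈ dualSlice K a, affineHilbertDist (coneSection K f) a b =
      1 / 2 * (Real.log (inner ℝ n' b) - Real.log (inner ℝ n b)) := by
  have hfv : f (b - a) = 0 := by simp [ha.2, hb.2]
  obtain ⟨n, hn, h1⟩ := hK.exists_neg_inner_eq_inv_exitTime ha hfv
  obtain ⟨n', hn', h2⟩ := hK.exists_neg_inner_eq_inv_exitTime (v := -(b - a)) ha (by simp [ha.2, hb.2])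
  rcases eq_or_ne a b with rfl | hab
  · exact ⟨n, hn, n, hn, by simp [affineHilbertDist]⟩
  have hv : b - a ≠ 0 := sub_ne_zero.mpr hab.symm
  have hT := hK.exitTime_pos ha hv hfv
  have hT' := hK.exitTime_pos ha (neg_ne_zero.mpr hv) (by simp [ha.2, hb.2])
  have hT1 := (hK.add_smul_mem_coneSection_iff ha hv hfv zero_le_one).mp (by simpa using hb)
  refine ⟨n, hn, n', hn', ?_⟩
  rw [hK.affineHilbertDist_eq ha hb hab]
  rw [inner_neg_right, neg_neg, inner_sub_right, hn'.2] at h2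
  rw [inner_sub_right, hn.2] at h1
  set T := exitTime (coneSection K f) a (b - a)
  set T' := exitTime (coneSection K f) a (-(b - a))
  have e1 : inner ℝ n' b = (T' + 1) / T' := by
    rw [sub_eq_iff_eq_add.mp h2]; field_simp; ring
  have e2 : inner ℝ n b = (T - 1) / T := by
    have : inner ℝ n b = 1 - T⁻¹ := by linarith
    rw [this]; field_simp
  rw [e1, e2, Real.log_div (by linarith) hT'.ne', Real.log_div (by linarith) hT.ne']
  ring

end IsSharpCone

/-! ### The cone over a properly convex open set -/

theorem mk_chartCoord {f : Module.Dual ℝ (Vec d)} {x : Proj d} (hx : x ∈ affineChart f) :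
    ∃ h : chartCoord f x ≠ 0, Projectivization.mk ℝ (chartCoord f x) h = x := by
  have h : chartCoord f x ≠ 0 := smul_ne_zero (inv_ne_zero hx) x.rep_nonzero
  refine ⟨h, ?_⟩
  conv_rhs => rw [← x.mk_rep]
  exact (Projectivization.mk_eq_mk_iff' ℝ _ _ _ _).mpr ⟨_, rfl⟩

namespace ProperlyConvexOpen

variable (Ω : ProperlyConvexOpen d)

theorem chart_spec : Ω.chart ≠ 0 ∧ Ω.carrier ⊆ affineChart Ω.chart ∧
    Convex ℝ (chartCoord Ω.chart '' Ω.carrier) ∧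
    Bornology.IsBounded (chartCoord Ω.chart '' Ω.carrier) :=
  Ω.properlyConvex.choose_spec

/-- The open cone over `Ω` on which the chart of `Ω` is positive. -/
def cone : Set (Vec d) :=
  {y | 0 < Ω.chart y ∧ ∃ h : y ≠ 0, Projectivization.mk ℝ y h ∈ Ω.carrier}

theorem chart_mk_ne_zero {u : Vec d} (hu : u ≠ 0) (h : Projectivization.mk ℝ u hu ∈ Ω) :
    Ω.chart u ≠ 0 :=
  (mem_affineChart_mk _ u hu).mp (Ω.chart_spec.2.1 h)

theorem inv_smul_mem_coneSection {u : Vec d} (hu : u ≠ 0) (h : Projectivization.mk ℝ u hu ∈ Ω) :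
    (Ω.chart u)⁻¹ • u ∈ coneSection Ω.cone Ω.chart := by
  have h0 := Ω.chart_mk_ne_zero hu h
  have h1 : Ω.chart ((Ω.chart u)⁻¹ • u) = 1 := by
    rw [map_smul, smul_eq_mul, inv_mul_cancel₀ h0]
  refine ⟨⟨by rw [h1]; exact one_pos, smul_ne_zero (inv_ne_zero h0) hu, ?_⟩, h1⟩
  have : Projectivization.mk ℝ ((Ω.chart u)⁻¹ • u) (smul_ne_zero (inv_ne_zero h0) hu) =
      Projectivization.mk ℝ u hu := (Projectivization.mk_eq_mk_iff' ℝ _ _ _ _).mpr ⟨_, rfl⟩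
  rw [this]
  exact h

theorem image_chartCoord : chartCoord Ω.chart '' Ω.carrier = coneSection Ω.cone Ω.chart := by
  ext y
  constructor
  · rintro ⟨x, hx, rfl⟩
    induction x using Projectivization.ind with
    | h v hv =>
      rw [chartCoord_mk]
      exact Ω.inv_smul_mem_coneSection hv hx
  · rintro ⟨⟨-, h, hy⟩, h1⟩
    exact ⟨_, hy, by rw [chartCoord_mk, h1, inv_one, one_smul]⟩

theorem isSharpCone : IsSharpCone Ω.cone Ω.chart := by
  obtain ⟨-, -, hconv, hbdd⟩ := Ω.chart_spec
  rw [image_chartCoord] at hconv hbdd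
  have hsec : ∀ {y : Vec d}, y ∈ Ω.cone → (Ω.chart y)⁻¹ • y ∈ coneSection Ω.cone Ω.chart :=
    fun hy => Ω.inv_smul_mem_coneSection hy.2.1 hy.2.2
  have hsmul : ∀ {c : ℝ} {y : Vec d}, 0 < c → y ∈ Ω.cone → c • y ∈ Ω.cone := by
    rintro c y hc ⟨h1, h2, h3⟩
    refine ⟨by rw [map_smul]; exact mul_pos hc h1, smul_ne_zero hc.ne' h2, ?_⟩
    have : Projectivization.mk ℝ (c • y) (smul_ne_zero hc.ne' h2) = Projectivization.mk ℝ y h2 :=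
      (Projectivization.mk_eq_mk_iff' ℝ _ _ _ _).mpr ⟨_, rfl⟩
    rw [this]
    exact h3
  refine ⟨?_, ?_, hsmul, fun hy => hy.1, ?_⟩
  · have h1 : IsOpen {u : {u : Vec d // u ≠ 0} | Projectivization.mk ℝ u.1 u.2 ∈ Ω.carrier} :=
      Ω.isOpen.preimage continuous_coinduced_rng
    have h2 := (isOpen_compl_singleton (x := (0 : Vec d))).isOpenMap_subtype_val _ h1
    have h3 : IsOpen {y : Vec d | 0 < Ω.chart y} :=
      isOpen_lt continuous_const Ω.chart.continuous_of_finiteDimensional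
    convert h3.inter h2 using 1
    ext y
    constructor
    · rintro ⟨h, h', h''⟩
      exact ⟨h, ⟨y, h'⟩, h'', rfl⟩
    · rintro ⟨h, ⟨z, h'⟩, h'', rfl⟩
      exact ⟨h, h', h''⟩
  · refine convex_iff_forall_pos.mpr fun y hy z hz s t hs ht _ => ?_
    have hy0 : 0 < s * Ω.chart y := mul_pos hs hy.1
    have hz0 : 0 < t * Ω.chart z := mul_pos ht hz.1
    have hk : 0 < s * Ω.chart y + t * Ω.chart z := add_pos hy0 hz0
    -- Up to scaling, `s • y + t • z` is a convex combination in the section, with weights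
    -- proportional to `s * Ω.chart y` and `t * Ω.chart z`.
    have h1 := hconv (hsec hy) (hsec hz) (div_nonneg hy0.le hk.le) (div_nonneg hz0.le hk.le)
      (by rw [← add_div, div_self hk.ne'])
    have h2 := hsmul hk h1.1
    convert h2 using 1
    rw [smul_add, smul_smul, smul_smul, smul_smul, smul_smul]
    have hy1 := hy.1.ne'
    have hz1 := hz.1.ne'
    congr 2 <;> field_simp
  · obtain ⟨R, hR⟩ := isBounded_iff_forall_norm_le.mp hbdd
    refine ⟨R, fun y hy => ?_⟩
    have h1 := hR _ (hsec hy)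
    rwa [norm_smul, norm_inv, Real.norm_of_nonneg hy.1.le, inv_mul_le_iff₀ hy.1, mul_comm] at h1

theorem exists_mem_coneSection {x : Proj d} (hx : x ∈ Ω) :
    ∃ a ∈ coneSection Ω.cone Ω.chart, ∃ h : a ≠ 0, Projectivization.mk ℝ a h = x := by
  obtain ⟨h, h1⟩ := mk_chartCoord (Ω.chart_spec.2.1 hx)
  refine ⟨_, ?_, h, h1⟩
  rw [← image_chartCoord]
  exact ⟨x, hx, rfl⟩

theorem mk_mem_of_mem_coneSection {a : Vec d} (ha : a ∈ coneSection Ω.cone Ω.chart) :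
    ∃ h : a ≠ 0, Projectivization.mk ℝ a h ∈ Ω := ha.1.2

end ProperlyConvexOpen

/-! ### Tangent vectors -/

theorem self_mem_submodule_mk (u : Vec d) (hu : u ≠ 0) :
    u ∈ (Projectivization.mk ℝ u hu).submodule := by
  rw [Projectivization.submodule_mk]
  exact Submodule.mem_span_singleton_self u

theorem projTangent_ext {u : Vec d} {hu : u ≠ 0} {φ ψ : ProjTangent (Projectivization.mk ℝ u hu)}
    (h : φ ⟨u, self_mem_submodule_mk u hu⟩ = ψ ⟨u, self_mem_submodule_mk u hu⟩) : φ = ψ := by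
  ext ⟨z, hz⟩
  have hz' := hz
  rw [Projectivization.submodule_mk, Submodule.mem_span_singleton] at hz'
  obtain ⟨c, rfl⟩ := hz'
  have : (⟨c • u, hz⟩ : (Projectivization.mk ℝ u hu).submodule) =
      c • ⟨u, self_mem_submodule_mk u hu⟩ := rfl
  rw [this, map_smul, map_smul, h]

theorem exists_mkDeriv_eq {u : Vec d} {hu : u ≠ 0} (φ : ProjTangent (Projectivization.mk ℝ u hu)) :
    ∃ w, mkDeriv u hu w = φ := by
  obtain ⟨w, hw⟩ := Submodule.mkQ_surjective _ (φ ⟨u, self_mem_submodule_mk u hu⟩)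
  exact ⟨w, projTangent_ext (by rw [mkDeriv_apply_self, hw])⟩

theorem mkDeriv_smul (u : Vec d) (hu : u ≠ 0) (c : ℝ) (w : Vec d) :
    mkDeriv u hu (c • w) = c • mkDeriv u hu w :=
  projTangent_ext (by rw [mkDeriv_apply_self, LinearMap.smul_apply, mkDeriv_apply_self, map_smul])

/-- Radial vectors are killed by the projection, so a lift of a tangent vector may be normalized
freely along `u`. -/
theorem mkDeriv_add_smul_self (u : Vec d) (hu : u ≠ 0) (c : ℝ) (w : Vec d) :
    mkDeriv u hu (w + c • u) = mkDeriv u hu w := by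
  refine projTangent_ext ?_
  rw [mkDeriv_apply_self, mkDeriv_apply_self, Submodule.mkQ_apply, Submodule.mkQ_apply,
    Submodule.Quotient.eq, add_sub_cancel_left]
  exact Submodule.smul_mem _ _ (self_mem_submodule_mk u hu)

theorem mem_span_of_mkDeriv_eq_zero {u : Vec d} {hu : u ≠ 0} {w : Vec d}
    (h : mkDeriv u hu w = 0) : w ∈ Submodule.span ℝ {u} := by
  have h1 := mkDeriv_apply_self u hu w (self_mem_submodule_mk u hu)
  rw [h, LinearMap.zero_apply, eq_comm, Submodule.mkQ_apply, Submodule.Quotient.mk_eq_zero,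
    Projectivization.submodule_mk] at h1
  exact h1

theorem projMapDeriv_mkDeriv (g : Vec d ≃ₗ[ℝ] Vec d) (u : Vec d) (hu : u ≠ 0) (w : Vec d) :
    projMapDeriv g (Projectivization.mk ℝ u hu) (mkDeriv u hu w) =
      mkDeriv (g u) ((map_ne_zero_iff g g.injective).mpr hu) (g w) := by
  refine projTangent_ext (u := g u) (hu := (map_ne_zero_iff g g.injective).mpr hu) ?_
  rw [mkDeriv_apply_self]
  have h1 : (g.symm.toLinearMap.restrict (p := (projMap g (Projectivization.mk ℝ u hu)).submodule)
      (q := (Projectivization.mk ℝ u hu).submodule) (by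
      intro z hz
      rw [projMap_submodule] at hz
      obtain ⟨w, hw, rfl⟩ := hz
      simpa using hw)) ⟨g u, self_mem_submodule_mk (g u) ((map_ne_zero_iff g g.injective).mpr hu)⟩ =
      ⟨u, self_mem_submodule_mk u hu⟩ := Subtype.ext (g.symm_apply_apply u)
  have h2 := (congrArg (mkDeriv u hu w) h1).trans (mkDeriv_apply_self u hu w _)
  exact congrArg (Submodule.mapQ (Projectivization.mk ℝ u hu).submodule
    (projMap g (Projectivization.mk ℝ u hu)).submodule g.toLinearMap (by
      rw [projMap_submodule]
      exact Submodule.le_comap_map _ _)) h2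

/-- This is the quotient rule for `u / f u`; the arbitrary representative chosen in
`chartCoordDeriv` differs from the expected one by a multiple of `u`, which cancels. -/
theorem chartCoordDeriv_mkDeriv (f : Module.Dual ℝ (Vec d)) (u : Vec d) (hu : u ≠ 0)
    (hf : f u ≠ 0) (w : Vec d) :
    chartCoordDeriv f (Projectivization.mk ℝ u hu) (mkDeriv u hu w) =
      (f u)⁻¹ • (w - (f w * (f u)⁻¹) • u) := by
  set x := Projectivization.mk ℝ u hu
  have hmem : (⟨chartCoord f x, chartCoord_mem f x⟩ : x.submodule) =
      (f u)⁻¹ • ⟨u, self_mem_submodule_mk u hu⟩ := Subtype.ext (chartCoord_mk f u hu)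
  have hval : mkDeriv u hu w ⟨chartCoord f x, chartCoord_mem f x⟩ =
      x.submodule.mkQ ((f u)⁻¹ • w) := by
    rw [hmem, map_smul, mkDeriv_apply_self, map_smul]
  have hsurj := Function.surjInv_eq x.submodule.mkQ_surjective
    (mkDeriv u hu w ⟨chartCoord f x, chartCoord_mem f x⟩)
  rw [chartCoordDeriv]
  set z := Function.surjInv x.submodule.mkQ_surjective
    (mkDeriv u hu w ⟨chartCoord f x, chartCoord_mem f x⟩)
  rw [hval, Submodule.mkQ_apply, Submodule.mkQ_apply, Submodule.Quotient.eq,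
    Projectivization.submodule_mk, Submodule.mem_span_singleton] at hsurj
  obtain ⟨c, hc⟩ := hsurj
  have hz : z = (f u)⁻¹ • w + c • u := by rw [hc]; abel
  change z - f z • chartCoord f x = _
  rw [chartCoord_mk, hz, map_add, map_smul, map_smul, smul_eq_mul, smul_eq_mul, smul_sub,
    smul_smul, smul_smul]
  have : ((f u)⁻¹ * f w + c * f u) * (f u)⁻¹ = (f u)⁻¹ * (f w * (f u)⁻¹) + c := by
    field_simp
  rw [this, add_smul]
  abel

/-! ### The Hilbert norm and the Hilbert distance in terms of the dual cone -/

/-- The logarithmic derivatives `inner ℝ n w / inner ℝ n u` do not change when `n` is rescaled, so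
the slice may be based at any `y`. One pair `n`, `n'` thus serves along a whole path. -/
theorem le_hilbertNorm (Ω : ProperlyConvexOpen d) {u : Vec d} (hu : u ≠ 0)
    (h : Projectivization.mk ℝ u hu ∈ Ω) (w : Vec d) {y n n' : Vec d}
    (hn : n ∈ dualSlice Ω.cone y) (hn' : n' ∈ dualSlice Ω.cone y) :
    1 / 2 * (inner ℝ n' w / inner ℝ n' u - inner ℝ n w / inner ℝ n u) ≤
      hilbertNorm Ω (Projectivization.mk ℝ u hu) (mkDeriv u hu w) := by
  have hf := Ω.chart_mk_ne_zero hu h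
  have ha := Ω.inv_smul_mem_coneSection hu h
  rw [hilbertNorm, chartCoordDeriv_mkDeriv _ _ _ hf, chartCoord_mk, Ω.image_chartCoord]
  set a := (Ω.chart u)⁻¹ • u with hadef
  have hv : Ω.chart ((Ω.chart u)⁻¹ • (w - (Ω.chart w * (Ω.chart u)⁻¹) • u)) = 0 := by
    rw [map_smul, map_sub, map_smul, smul_eq_mul, smul_eq_mul]
    field_simp
    simp
  have hp : ∀ {m : Vec d}, m ∈ dualSlice Ω.cone y → 0 < inner ℝ m a := fun hm =>
    inner_pos_of_mem_dualSlice Ω.isSharpCone.isOpen hm ha.1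
  have key := Ω.isSharpCone.le_affineHilbertNorm ha hv (smul_mem_dualSlice hn.1 (hp hn))
    (smul_mem_dualSlice hn'.1 (hp hn'))
  refine le_of_eq_of_le ?_ key
  have e : ∀ m : Vec d, m ∈ dualSlice Ω.cone y →
      inner ℝ ((inner ℝ m a)⁻¹ • m) ((Ω.chart u)⁻¹ • (w - (Ω.chart w * (Ω.chart u)⁻¹) • u)) =
        inner ℝ m w / inner ℝ m u - Ω.chart w * (Ω.chart u)⁻¹ := by
    intro m hm
    have h1 := (hp hm).ne'
    rw [hadef, inner_smul_right] at h1
    have h2 := right_ne_zero_of_mul h1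
    rw [hadef, real_inner_smul_left, inner_smul_right, inner_smul_right, inner_sub_right,
      inner_smul_right]
    field_simp
  rw [e n hn, e n' hn']
  ring

theorem exists_hilbertNorm_eq (Ω : ProperlyConvexOpen d) {a : Vec d} (ha0 : a ≠ 0)
    (ha : a ∈ coneSection Ω.cone Ω.chart) (w : Vec d) :
    ∃ n ∈ dualSlice Ω.cone a, ∃ n' ∈ dualSlice Ω.cone a,
      hilbertNorm Ω (Projectivization.mk ℝ a ha0) (mkDeriv a ha0 w) =
        1 / 2 * (inner ℝ n' w - inner ℝ n w) := by
  rw [hilbertNorm, chartCoordDeriv_mkDeriv _ _ _ (by rw [ha.2]; exact one_ne_zero), chartCoord_mk,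
    Ω.image_chartCoord, ha.2, inv_one, one_smul, one_smul, mul_one]
  obtain ⟨n, hn, n', hn', h⟩ := Ω.isSharpCone.exists_affineHilbertNorm_eq
    (v := w - Ω.chart w • a) ha (by simp [ha.2])
  refine ⟨n, hn, n', hn', ?_⟩
  rw [h, inner_sub_right, inner_sub_right, inner_smul_right, inner_smul_right, hn.2, hn'.2]
  ring

/-! ### A compact family of properly convex sets -/

/-- The vector with all coordinates equal to `1`. -/
noncomputable def ones (d : ℕ) : Vec d := WithLp.toLp 2 fun _ => 1

/-- The sum of the coordinates. -/
noncomputable def coordSum (d : ℕ) : Module.Dual ℝ (Vec d) := (innerSL ℝ (ones d)).toLinearMap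

theorem coordSum_eq_inner (z : Vec d) : coordSum d z = inner ℝ (ones d) z := rfl

theorem coordSum_apply (z : Vec d) : coordSum d z = ∑ i, z i := by
  rw [coordSum_eq_inner, PiLp.inner_apply]
  simp [ones]

theorem coordSum_ones : coordSum d (ones d) = d + 1 := by
  rw [coordSum_apply]
  simp [ones]

theorem ones_ne_zero : ones d ≠ 0 := by
  intro h
  have h1 := coordSum_ones (d := d)
  rw [h, map_zero] at h1
  have : (0 : ℝ) < d + 1 := by positivity
  linarith

theorem continuous_coordSum : Continuous (coordSum d) :=
  (coordSum d).continuous_of_finiteDimensional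

theorem norm_le_sum_abs (z : Vec d) : ‖z‖ ≤ ∑ i, |z i| := by
  rw [EuclideanSpace.norm_eq]
  refine Real.sqrt_le_iff.mpr ⟨Finset.sum_nonneg fun i _ => abs_nonneg _, ?_⟩
  simp only [Real.norm_eq_abs]
  exact Finset.sum_sq_le_sq_sum_of_nonneg fun i _ => abs_nonneg _

/-- The points of the positive orthant with coordinate sum close to `d + 1`. -/
def normalBox (d : ℕ) : Set (Vec d) :=
  {z | (∀ i, 0 ≤ z i) ∧ |coordSum d z - (d + 1)| ≤ 3 / 4}

theorem isCompact_normalBox : IsCompact (normalBox d) := by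
  refine Metric.isCompact_of_isClosed_isBounded ?_ ?_
  · have h1 : IsClosed {z : Vec d | ∀ i, 0 ≤ z i} := by
      simp only [Set.ofPred_forall]
      exact isClosed_iInter fun i => isClosed_le continuous_const (by fun_prop)
    exact h1.inter (isClosed_le ((continuous_coordSum.sub continuous_const).abs) continuous_const)
  · refine isBounded_iff_forall_norm_le.mpr ⟨d + 2, fun z hz => ?_⟩
    have h1 := norm_le_sum_abs z
    simp only [fun i => abs_of_nonneg (hz.1 i)] at h1
    rw [← coordSum_apply] at h1
    linarith [(abs_le.mp hz.2).2]

theorem quarter_le_coordSum {z : Vec d} (hz : z ∈ normalBox d) : 1 / 4 ≤ coordSum d z := by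
  have := (abs_le.mp hz.2).1
  have : (0 : ℝ) ≤ d := d.cast_nonneg
  linarith

theorem le_norm_of_mem_normalBox {z : Vec d} (hz : z ∈ normalBox d) :
    (4 * ‖ones d‖)⁻¹ ≤ ‖z‖ := by
  have h1 := quarter_le_coordSum hz
  have h2 := real_inner_le_norm (ones d) z
  rw [← coordSum_eq_inner] at h2
  have h3 : 0 < ‖ones d‖ := norm_pos_iff.mpr ones_ne_zero
  rw [inv_le_iff_one_le_mul₀ (by positivity)]
  linarith

theorem ne_zero_of_mem_normalBox {z : Vec d} (hz : z ∈ normalBox d) : z ≠ 0 := by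
  rintro rfl
  have := quarter_le_coordSum hz
  rw [map_zero] at this
  linarith

/-- The radius of a ball around `ones d` which all the normalized bodies contain. -/
noncomputable def normalRadius (d : ℕ) : ℝ := (2 * (d + 1))⁻¹

theorem normalRadius_pos : 0 < normalRadius d := by
  unfold normalRadius; positivity

/-- Convex bodies around `ones d` contained in `normalBox d`. -/
def normalBodies (d : ℕ) : Set (TopologicalSpace.NonemptyCompacts (Vec d)) :=
  {A | Convex ℝ (A : Set (Vec d)) ∧ Metric.closedBall (ones d) (normalRadius d) ⊆ A ∧
    (A : Set (Vec d)) ⊆ normalBox d}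

/-- Convexity is the family of equations `(s • A + t • A) ⊔ A = A`, whose sides depend continuously
on `A`. -/
theorem isClosed_setOf_convex_nonemptyCompacts {E : Type*} [NormedAddCommGroup E]
    [NormedSpace ℝ E] :
    IsClosed {A : TopologicalSpace.NonemptyCompacts E | Convex ℝ (A : Set E)} := by
  have h : {A : TopologicalSpace.NonemptyCompacts E | Convex ℝ (A : Set E)} =
      ⋂ (s : ℝ) (t : ℝ) (_ : 0 ≤ s ∧ 0 ≤ t ∧ s + t = 1),
        {A | (A ×ˢ A).map (fun p : E × E => s • p.1 + t • p.2) (by fun_prop) ⊔ A = A} := by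
    ext A
    simp only [mem_iInter, mem_ofPred_eq]
    constructor
    · rintro hA s t ⟨hs, ht, hst⟩
      refine sup_eq_right.mpr ?_
      rintro _ ⟨p, hp, rfl⟩
      exact hA hp.1 hp.2 hs ht hst
    · intro hA x hx y hy s t hs ht hst
      have := sup_eq_right.mp (hA s t ⟨hs, ht, hst⟩)
      exact this ⟨(x, y), ⟨hx, hy⟩, rfl⟩
  rw [h]
  refine isClosed_iInter fun s => isClosed_iInter fun t => isClosed_iInter fun _ => ?_
  refine isClosed_eq (Continuous.sup ?_ continuous_id) continuous_id
  have h1 : Continuous (fun A : TopologicalSpace.NonemptyCompacts E => A ×ˢ A) :=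
    TopologicalSpace.NonemptyCompacts.continuous_prod.comp (continuous_id.prodMk continuous_id)
  exact (Continuous.nonemptyCompacts_map (f := fun p : E × E => s • p.1 + t • p.2)
    (by fun_prop)).comp h1

/-- Blaschke selection: the compact subsets of a compact set form a compact space, and convexity and
containing the ball are closed conditions. -/
theorem isCompact_normalBodies : IsCompact (normalBodies d) := by
  have h1 : IsClosed {A : TopologicalSpace.NonemptyCompacts (Vec d) |
      Metric.closedBall (ones d) (normalRadius d) ⊆ (A : Set (Vec d))} := by
    have : {A : TopologicalSpace.NonemptyCompacts (Vec d) |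
        Metric.closedBall (ones d) (normalRadius d) ⊆ (A : Set (Vec d))} =
        ⋂ p ∈ Metric.closedBall (ones d) (normalRadius d), 
          {A : TopologicalSpace.NonemptyCompacts (Vec d) | ((A : Set (Vec d)) ∩ {p}).Nonempty} := by
      ext A
      simp [Set.subset_def]
    rw [this]
    exact isClosed_biInter fun p _ =>
      TopologicalSpace.NonemptyCompacts.isClosed_inter_nonempty_of_isClosed isClosed_singleton
  have h2 := TopologicalSpace.NonemptyCompacts.isCompact_subsets_of_isCompact
    (isCompact_normalBox (d := d))
  convert h2.inter_left (isClosed_setOf_convex_nonemptyCompacts.inter h1) using 1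
  ext A
  simp [normalBodies, and_assoc]

/-- The properly convex open set spanned by the interior of a normalized body. -/
def normalSet (A : normalBodies d) : ProperlyConvexOpen d where
  carrier := {x | ∃ y ∈ interior (A.1 : Set (Vec d)), ∃ h : y ≠ 0, Projectivization.mk ℝ y h = x}
  isOpen := by
    refine isOpen_coinduced.mpr ?_
    have : (fun u : {u : Vec d // u ≠ 0} => Projectivization.mk ℝ u.1 u.2) ⁻¹'
        {x | ∃ y ∈ interior (A.1 : Set (Vec d)), ∃ h : y ≠ 0, Projectivization.mk ℝ y h = x} =
        ⋃ c : ℝ, {u : {u : Vec d // u ≠ 0} | c • u.1 ∈ interior (A.1 : Set (Vec d))} := by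
      ext u
      simp only [mem_preimage, mem_ofPred_eq, mem_iUnion]
      constructor
      · rintro ⟨y, hy, h, hyu⟩
        obtain ⟨c, rfl⟩ := (Projectivization.mk_eq_mk_iff' ℝ _ _ _ _).mp hyu
        exact ⟨c, hy⟩
      · rintro ⟨c, hc⟩
        exact ⟨_, hc, ne_zero_of_mem_normalBox (A.2.2.2 (interior_subset hc)),
          (Projectivization.mk_eq_mk_iff' ℝ _ _ _ _).mpr ⟨c, rfl⟩⟩
    rw [this]
    refine isOpen_iUnion fun c => isOpen_interior.preimage ?_
    fun_prop
  properlyConvex := by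
    have hbox : ∀ {y}, y ∈ interior (A.1 : Set (Vec d)) → y ∈ normalBox d :=
      fun hy => A.2.2.2 (interior_subset hy)
    have hpos : ∀ {y}, y ∈ interior (A.1 : Set (Vec d)) → 0 < coordSum d y := fun hy => by
      linarith [quarter_le_coordSum (hbox hy)]
    have himg : chartCoord (coordSum d) '' {x | ∃ y ∈ interior (A.1 : Set (Vec d)), ∃ h : y ≠ 0,
        Projectivization.mk ℝ y h = x} =
        (fun y => (coordSum d y)⁻¹ • y) '' interior (A.1 : Set (Vec d)) := by
      ext z
      constructor
      · rintro ⟨_, ⟨y, hy, h, rfl⟩, rfl⟩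
        exact ⟨y, hy, (chartCoord_mk _ _ _).symm⟩
      · rintro ⟨y, hy, rfl⟩
        exact ⟨_, ⟨y, hy, ne_zero_of_mem_normalBox (hbox hy), rfl⟩, chartCoord_mk _ _ _⟩
    refine ⟨coordSum d, ?_, ?_, ?_, ?_⟩
    · intro h
      have h1 := coordSum_ones (d := d)
      rw [h, LinearMap.zero_apply] at h1
      have : (0 : ℝ) < d + 1 := by positivity
      linarith
    · rintro _ ⟨y, hy, h, rfl⟩
      rw [mem_affineChart_mk]
      exact (hpos hy).ne'
    · rw [himg]
      refine convex_iff_forall_pos.mpr ?_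
      rintro _ ⟨y, hy, rfl⟩ _ ⟨z, hz, rfl⟩ s t hs ht hst
      have hy1 := hpos hy
      have hz1 := hpos hz
      set k := s / coordSum d y + t / coordSum d z with hk
      have hk0 : 0 < k := by positivity
      -- The weights are adapted so that radial projection to coordinate sum `1` gives the
      -- prescribed combination.
      refine ⟨(s / coordSum d y / k) • y + (t / coordSum d z / k) • z,
        A.2.1.interior hy hz (by positivity) (by positivity)
          (by rw [← add_div, ← hk, div_self hk0.ne']), ?_⟩
      have h1 : coordSum d ((s / coordSum d y / k) • y + (t / coordSum d z / k) • z) = k⁻¹ := by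
        rw [map_add, map_smul, map_smul, smul_eq_mul, smul_eq_mul, inv_eq_one_div, ← hst]
        field_simp
      simp only [h1, inv_inv]
      rw [smul_add, smul_smul, smul_smul, smul_smul, smul_smul]
      congr 2 <;> field_simp
    · rw [himg, isBounded_iff_forall_norm_le]
      obtain ⟨R, hR⟩ := isBounded_iff_forall_norm_le.mp (isCompact_normalBox (d := d)).isBounded
      refine ⟨4 * R, ?_⟩
      rintro _ ⟨y, hy, rfl⟩
      have h1 := quarter_le_coordSum (hbox hy)
      have h2 := hR _ (hbox hy)
      rw [norm_smul, norm_inv, Real.norm_of_nonneg (hpos hy).le]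
      have h3 : (coordSum d y)⁻¹ ≤ 4 := by
        rw [inv_le_comm₀ (hpos hy) (by norm_num)]; linarith
      gcongr

theorem mk_ones_mem_normalSet (A : normalBodies d) :
    Projectivization.mk ℝ (ones d) ones_ne_zero ∈ normalSet A :=
  ⟨ones d, interior_maximal (Metric.ball_subset_closedBall.trans A.2.2.1) Metric.isOpen_ball
    (Metric.mem_ball_self normalRadius_pos), _, rfl⟩

/-! ### Hausdorff continuity of the normalized family. -/

theorem norm_inv_norm_smul_sub_le {E : Type*} [NormedAddCommGroup E] [NormedSpace ℝ E] {y z : E}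
    (hy : y ≠ 0) (hz : z ≠ 0) : ‖‖y‖⁻¹ • y - ‖z‖⁻¹ • z‖ ≤ 2 * ‖y‖⁻¹ * ‖y - z‖ := by
  have hy0 : 0 < ‖y‖ := norm_pos_iff.mpr hy
  have hz0 : 0 < ‖z‖ := norm_pos_iff.mpr hz
  have h1 : ‖y‖⁻¹ • y - ‖z‖⁻¹ • z = ‖y‖⁻¹ • (y - z) + (‖y‖⁻¹ - ‖z‖⁻¹) • z := by module
  have h2 : ‖(‖y‖⁻¹ - ‖z‖⁻¹) • z‖ = ‖y‖⁻¹ * |‖z‖ - ‖y‖| := by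
    have : ‖y‖⁻¹ - ‖z‖⁻¹ = ‖y‖⁻¹ * ‖z‖⁻¹ * (‖z‖ - ‖y‖) := by field_simp
    rw [norm_smul, this, norm_mul, Real.norm_eq_abs (‖z‖ - ‖y‖), Real.norm_of_nonneg (by positivity)]
    field_simp
  have h3 : |‖z‖ - ‖y‖| ≤ ‖y - z‖ := by
    rw [abs_sub_comm]; exact abs_norm_sub_norm_le y z
  calc ‖‖y‖⁻¹ • y - ‖z‖⁻¹ • z‖ ≤ ‖‖y‖⁻¹ • (y - z)‖ + ‖(‖y‖⁻¹ - ‖z‖⁻¹) • z‖ := by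
        rw [h1]; exact norm_add_le _ _
    _ ≤ ‖y‖⁻¹ * ‖y - z‖ + ‖y‖⁻¹ * ‖y - z‖ := by
        rw [h2, norm_smul, norm_inv, norm_norm]; gcongr
    _ = 2 * ‖y‖⁻¹ * ‖y - z‖ := by ring

/-- Normalizing vectors is Lipschitz away from `0`, and the boxes stay away from `0`. The unit lift
`u` may be opposite to `y`; the unit lift of `z` is then taken with the same sign. -/
theorem exists_mem_unitLift_norm_sub_le (A B : normalBodies d) {u y z : Vec d}
    (hu : ‖u‖ = 1) (hy : y ∈ interior (A.1 : Set (Vec d))) {c : ℝ} (huc : c • u = y)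
    (hz : z ∈ interior (B.1 : Set (Vec d))) :
    ∃ u' ∈ unitLift (normalSet B).carrier, ‖u - u'‖ ≤ 8 * ‖ones d‖ * ‖y - z‖ := by
  have hy0 := ne_zero_of_mem_normalBox (A.2.2.2 (interior_subset hy))
  have hz0 := ne_zero_of_mem_normalBox (B.2.2.2 (interior_subset hz))
  have hyn := le_norm_of_mem_normalBox (A.2.2.2 (interior_subset hy))
  have hones : 0 < ‖ones d‖ := norm_pos_iff.mpr ones_ne_zero
  have hzn : 0 < ‖z‖ := norm_pos_iff.mpr hz0
  have hc : c ≠ 0 := by rintro rfl; exact hy0 (by rw [← huc, zero_smul])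
  have hmem : ∀ s : ℝ, |s| = 1 → s • ‖z‖⁻¹ • z ∈ unitLift (normalSet B).carrier := by
    intro s hs
    have hs0 : s ≠ 0 := by rintro rfl; simp at hs
    refine ⟨?_, smul_ne_zero hs0 (smul_ne_zero (inv_ne_zero hzn.ne') hz0), z, hz, hz0, ?_⟩
    · rw [norm_smul, norm_smul, norm_inv, norm_norm, inv_mul_cancel₀ hzn.ne', Real.norm_eq_abs,
        hs, mul_one]
    · refine (Projectivization.mk_eq_mk_iff' ℝ _ _ _ _).mpr ⟨‖z‖ * s⁻¹, ?_⟩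
      rw [smul_smul, smul_smul]
      have : ‖z‖ * s⁻¹ * s * ‖z‖⁻¹ = 1 := by field_simp
      rw [this, one_smul]
  have hsign : |c * |c|⁻¹| = 1 := by
    rw [abs_mul, abs_inv, abs_abs, mul_inv_cancel₀ (abs_ne_zero.mpr hc)]
  refine ⟨_, hmem (c * |c|⁻¹) hsign, ?_⟩
  have h1 : u = (c * |c|⁻¹) • ‖y‖⁻¹ • y := by
    rw [← huc, norm_smul, hu, mul_one, Real.norm_eq_abs, smul_smul, smul_smul]
    have h2 : c * |c|⁻¹ * (|c|⁻¹ * c) = 1 := by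
      have h3 : c * |c|⁻¹ * (|c|⁻¹ * c) = c * c * (|c| * |c|)⁻¹ := by rw [mul_inv]; ring
      rw [h3, abs_mul_abs_self, mul_inv_cancel₀ (mul_ne_zero hc hc)]
    rw [← mul_assoc] at h2
    rw [h2, one_smul]
  have h2 : ‖y‖⁻¹ ≤ 4 * ‖ones d‖ := by
    rw [inv_le_comm₀ (norm_pos_iff.mpr hy0) (by positivity)]; exact hyn
  calc ‖u - (c * |c|⁻¹) • ‖z‖⁻¹ • z‖ = ‖‖y‖⁻¹ • y - ‖z‖⁻¹ • z‖ := by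
        conv_lhs => rw [h1]
        rw [← smul_sub, norm_smul, Real.norm_eq_abs, hsign, one_mul]
    _ ≤ 2 * ‖y‖⁻¹ * ‖y - z‖ := norm_inv_norm_smul_sub_le hy0 hz0
    _ ≤ 2 * (4 * ‖ones d‖) * ‖y - z‖ := by gcongr
    _ = 8 * ‖ones d‖ * ‖y - z‖ := by ring

/-- The compact family consists of closed bodies and `X` of open sets; as closures do not change
Hausdorff distances, this identity passes from one to the other. -/
theorem closure_interior_normalBody (A : normalBodies d) :
    closure (interior (A.1 : Set (Vec d))) = A.1 := by
  rw [A.2.1.closure_interior_eq_closure_of_nonempty_interior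
    ⟨ones d, interior_maximal (Metric.ball_subset_closedBall.trans A.2.2.1) Metric.isOpen_ball
      (Metric.mem_ball_self normalRadius_pos)⟩, A.1.isCompact.isClosed.closure_eq]

theorem hausdorffEDist_unitLift_normalSet_le (A B : normalBodies d) :
    Metric.hausdorffEDist (unitLift (normalSet A).carrier) (unitLift (normalSet B).carrier) ≤
      ENNReal.ofReal (8 * ‖ones d‖) * Metric.hausdorffEDist (A.1 : Set (Vec d)) B.1 := by
  have hones : 0 < ‖ones d‖ := norm_pos_iff.mpr ones_ne_zero
  have hC0 : ENNReal.ofReal (8 * ‖ones d‖) ≠ 0 := by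
    rw [Ne, ENNReal.ofReal_eq_zero, not_le]; positivity
  have hCt : ENNReal.ofReal (8 * ‖ones d‖) ≠ ⊤ := ENNReal.ofReal_ne_top
  have key : ∀ A B : normalBodies d, ∀ r : ENNReal,
      Metric.hausdorffEDist (interior (A.1 : Set (Vec d))) (interior (B.1 : Set (Vec d))) < r →
      ∀ u ∈ unitLift (normalSet A).carrier, ∃ u' ∈ unitLift (normalSet B).carrier,
        edist u u' ≤ ENNReal.ofReal (8 * ‖ones d‖) * r := by
    rintro A B r hr u ⟨hu, hu0, y, hy, hy0, hyu⟩
    obtain ⟨c, hc⟩ := (Projectivization.mk_eq_mk_iff' ℝ _ _ _ _).mp hyu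
    obtain ⟨z, hz, hyz⟩ := Metric.exists_edist_lt_of_hausdorffEDist_lt hy hr
    obtain ⟨u', hu', h⟩ := exists_mem_unitLift_norm_sub_le A B hu hy hc hz
    refine ⟨u', hu', ?_⟩
    calc edist u u' = ENNReal.ofReal ‖u - u'‖ := by rw [edist_dist, dist_eq_norm]
      _ ≤ ENNReal.ofReal (8 * ‖ones d‖ * ‖y - z‖) := ENNReal.ofReal_le_ofReal h
      _ = ENNReal.ofReal (8 * ‖ones d‖) * edist y z := by
        rw [ENNReal.ofReal_mul (by positivity), edist_dist, dist_eq_norm]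
      _ ≤ _ := by gcongr
  rw [mul_comm, ← ENNReal.div_le_iff_le_mul (Or.inl hC0) (Or.inl hCt)]
  -- Interiors need not contain nearest points, so the bound is proved for every `r` above the
  -- distance.
  refine le_of_forall_gt_imp_ge_of_dense fun r hr => ?_
  rw [← closure_interior_normalBody A, ← closure_interior_normalBody B,
    Metric.hausdorffEDist_closure] at hr
  rw [ENNReal.div_le_iff_le_mul (Or.inl hC0) (Or.inl hCt), mul_comm]
  refine Metric.hausdorffEDist_le_of_mem_edist (key A B r hr) (key B A r ?_)
  rwa [Metric.hausdorffEDist_comm]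

theorem continuous_normalSet : Continuous (normalSet (d := d)) := by
  let _ : PseudoEMetricSpace (ProperlyConvexOpen d) :=
    PseudoEMetricSpace.induced (fun Ω : ProperlyConvexOpen d => unitLift Ω.carrier)
      PseudoEMetricSpace.hausdorff
  have h : LipschitzWith (8 * ‖ones d‖).toNNReal (normalSet (d := d)) :=
    fun A B => hausdorffEDist_unitLift_normalSet_le A B
  exact h.continuous

/-! ### Comparison of a natural metric with the Hilbert norm -/

/-- The norm of the tangent vector at `[u]` represented by `w`. -/
noncomputable def ProjectiveMetric.liftNorm (F : ProjectiveMetric d) (Ω : ProperlyConvexOpen d) (u : Vec d)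
    (hu : u ≠ 0) (h : Projectivization.mk ℝ u hu ∈ Ω) (w : Vec d) : ℝ :=
  F.norm Ω (Projectivization.mk ℝ u hu) h (mkDeriv u hu w)

/-- Representing tangent vectors by vectors `w` of a fixed space allows `Ω` and `u` to be replaced
by equal ones without transport between tangent spaces. -/
theorem ProjectiveMetric.liftNorm_congr (F : ProjectiveMetric d) {Ω Ω' : ProperlyConvexOpen d}
    {u u' : Vec d} {hu : u ≠ 0} {h : Projectivization.mk ℝ u hu ∈ Ω} (w : Vec d)
    (hΩ : Ω = Ω') (huu : u = u') (hu' : u' ≠ 0) (h' : Projectivization.mk ℝ u' hu' ∈ Ω') :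
    F.liftNorm Ω u hu h w = F.liftNorm Ω' u' hu' h' w := by
  subst hΩ huu
  rfl

theorem ProjectiveMetric.IsNatural.liftNorm_map {F : ProjectiveMetric d} (hF : F.IsNatural)
    (g : Vec d ≃ₗ[ℝ] Vec d) (Ω : ProperlyConvexOpen d) (u : Vec d) (hu : u ≠ 0)
    (h : Projectivization.mk ℝ u hu ∈ Ω) (w : Vec d) :
    F.liftNorm (Ω.map g) (g u) ((map_ne_zero_iff g g.injective).mpr hu) (projMap_mem_map g h) (g w) =
      F.liftNorm Ω u hu h w := by
  have h1 := hF.invariant g Ω _ h (mkDeriv u hu w)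
  rw [projMapDeriv_mkDeriv] at h1
  exact h1

theorem ProjectiveMetric.liftNorm_smul (F : ProjectiveMetric d) (Ω : ProperlyConvexOpen d) (u : Vec d)
    (hu : u ≠ 0) (h : Projectivization.mk ℝ u hu ∈ Ω) (c : ℝ) (w : Vec d) :
    F.liftNorm Ω u hu h (c • w) = |c| * F.liftNorm Ω u hu h w := by
  rw [liftNorm, mkDeriv_smul, map_smul_eq_mul, Real.norm_eq_abs, liftNorm]

theorem continuous_tangentMk : Continuous (fun p : {u : Vec d // u ≠ 0} × Vec d =>
    (⟨Projectivization.mk ℝ p.1.1 p.1.2, mkDeriv p.1.1 p.1.2 p.2⟩ : ProjTangentBundle d)) :=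
  continuous_coinduced_rng

theorem ProjectiveMetric.IsNatural.continuous_liftNorm {F : ProjectiveMetric d} (hF : F.IsNatural)
    {T : Type*} [TopologicalSpace T] {Ω : T → ProperlyConvexOpen d} {u w : T → Vec d}
    (hΩ : Continuous Ω) (hu : Continuous u) (hw : Continuous w) (hu0 : ∀ t, u t ≠ 0)
    (h : ∀ t, Projectivization.mk ℝ (u t) (hu0 t) ∈ Ω t) :
    Continuous fun t => F.liftNorm (Ω t) (u t) (hu0 t) (h t) (w t) := by
  have h1 : Continuous fun t : T => (⟨(Ω t, ⟨Projectivization.mk ℝ (u t) (hu0 t),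
      mkDeriv (u t) (hu0 t) (w t)⟩), h t⟩ : PointedTangent d) :=
    (hΩ.prodMk (continuous_tangentMk.comp ((hu.subtype_mk hu0).prodMk hw))).subtype_mk _
  exact hF.continuous.comp h1

/-- The hyperplane of coordinate sum `0` is transverse to the line of `ones d`, so it models the
tangent space there. -/
theorem eq_zero_of_mkDeriv_ones_eq_zero {z : Vec d} (hz : coordSum d z = 0)
    (h : mkDeriv (ones d) ones_ne_zero z = 0) : z = 0 := by
  obtain ⟨c, rfl⟩ := Submodule.mem_span_singleton.mp (mem_span_of_mkDeriv_eq_zero h)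
  rw [map_smul, coordSum_ones, smul_eq_mul] at hz
  have h1 : (0 : ℝ) < d + 1 := by positivity
  rcases mul_eq_zero.mp hz with h2 | h2
  · rw [h2, zero_smul]
  · linarith

theorem ProjectiveMetric.IsNatural.exists_bounds_normalSet {F : ProjectiveMetric d}
    (hF : F.IsNatural) : ∃ m M : ℝ, 0 < m ∧ 0 < M ∧ ∀ (A : normalBodies d) (z : Vec d),
      coordSum d z = 0 →
      m * ‖z‖ ≤ F.liftNorm (normalSet A) (ones d) ones_ne_zero (mk_ones_mem_normalSet A) z ∧
      F.liftNorm (normalSet A) (ones d) ones_ne_zero (mk_ones_mem_normalSet A) z ≤ M * ‖z‖ := by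
  let S : Set (Vec d) := Metric.sphere 0 1 ∩ {z | coordSum d z = 0}
  have hS : IsCompact S := (isCompact_sphere 0 1).inter_right
    (isClosed_eq continuous_coordSum continuous_const)
  have : CompactSpace S := isCompact_iff_compactSpace.mp hS
  have : CompactSpace (normalBodies d) := isCompact_iff_compactSpace.mp isCompact_normalBodies
  let G : normalBodies d × S → ℝ := fun p =>
    F.liftNorm (normalSet p.1) (ones d) ones_ne_zero (mk_ones_mem_normalSet p.1) p.2
  have hG : Continuous G := hF.continuous_liftNorm (continuous_normalSet.comp continuous_fst)
    continuous_const (continuous_subtype_val.comp continuous_snd) _ _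
  have hpos : ∀ p, 0 < G p := by
    intro p
    refine (apply_nonneg _ _).lt_of_ne' fun h => ?_
    have h1 := eq_zero_of_mkDeriv_ones_eq_zero p.2.2.2 (F.definite _ _ _ _ h)
    have h2 := p.2.2.1
    rw [h1] at h2
    simp at h2
  obtain ⟨m, M, hm, hM, hb⟩ : ∃ m M : ℝ, 0 < m ∧ 0 < M ∧ ∀ p, m ≤ G p ∧ G p ≤ M := by
    -- The product is empty for `d = 0`, where no vector of sum `0` is a unit vector.
    rcases isEmpty_or_nonempty (normalBodies d × S) with he | hne
    · exact ⟨1, 1, one_pos, one_pos, fun p => he.elim p⟩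
    obtain ⟨p, -, hp⟩ := isCompact_univ.exists_isMinOn univ_nonempty hG.continuousOn
    obtain ⟨q, -, hq⟩ := isCompact_univ.exists_isMaxOn univ_nonempty hG.continuousOn
    exact ⟨G p, G q, hpos p, hpos q, fun r => ⟨hp (mem_univ r), hq (mem_univ r)⟩⟩
  refine ⟨m, M, hm, hM, fun A z hz => ?_⟩
  rcases eq_or_ne z 0 with rfl | hz0
  · have := F.liftNorm_smul (normalSet A) (ones d) ones_ne_zero (mk_ones_mem_normalSet A) 0 0
    rw [zero_smul, abs_zero, zero_mul] at this
    rw [this]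
    simp
  have hzn : 0 < ‖z‖ := norm_pos_iff.mpr hz0
  have hmem : ‖z‖⁻¹ • z ∈ S := by
    refine ⟨?_, ?_⟩
    · rw [mem_sphere_zero_iff_norm, norm_smul, norm_inv, norm_norm, inv_mul_cancel₀ hzn.ne']
    · rw [mem_ofPred_eq, map_smul, hz, smul_zero]
  have h1 := hb (A, ⟨_, hmem⟩)
  simp only [G] at h1
  rw [ProjectiveMetric.liftNorm_smul, abs_inv, abs_norm, inv_mul_eq_div, le_div_iff₀ hzn,
    div_le_iff₀ hzn] at h1
  exact h1

/-- Benzécri's normalization: every pointed properly convex open set is projectively equivalent to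
one of a compact family. -/
theorem exists_map_eq_normalSet (Ω : ProperlyConvexOpen d) {a : Vec d} (ha : a ∈ Ω.cone) :
    ∃ (n : Fin (d + 1) → Vec d) (g : Vec d ≃ₗ[ℝ] Vec d) (A : normalBodies d),
      (∀ i, n i ∈ dualSlice Ω.cone a) ∧ (∀ y i, g y i = inner ℝ (n i) y) ∧ g a = ones d ∧
      Ω.map g = normalSet A ∧
      ∀ m ∈ dualSlice Ω.cone a, ∃ c : Fin (d + 1) → ℝ, (∀ i, |c i| ≤ 1) ∧ m = ∑ i, c i • n i := by
  obtain ⟨n, hn, hspan, hcoef⟩ := Ω.isSharpCone.exists_maximal_simplex ha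
  let L : Vec d →ₗ[ℝ] Vec d :=
    { toFun := fun y => WithLp.toLp 2 fun i => inner ℝ (n i) y
      map_add' := fun x y => by ext i; simp [inner_add_right]
      map_smul' := fun c y => by ext i; simp [inner_smul_right] }
  have hLi : ∀ y i, L y i = inner ℝ (n i) y := fun y i => rfl
  have hinj : Function.Injective L := by
    refine (injective_iff_map_eq_zero L).mpr fun y hy => ?_
    obtain ⟨c, hc⟩ := hspan y
    have : inner ℝ y y = (0 : ℝ) := by
      conv_lhs => lhs; rw [hc]
      rw [sum_inner]
      refine Finset.sum_eq_zero fun i _ => ?_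
      rw [real_inner_smul_left, ← hLi, hy]
      simp
    exact inner_self_eq_zero.mp this
  let g : Vec d ≃ₗ[ℝ] Vec d := LinearEquiv.ofInjectiveEndo L hinj
  have hgi : ∀ y i, g y i = inner ℝ (n i) y := fun y i => rfl
  have hga : g a = ones d := by
    ext i
    rw [hgi, (hn i).2]
    rfl
  -- The width `3 / 4` exceeds `1 / 2`, the variation of the sum allowed on the ball below, and is
  -- less than `1`, which keeps the sums away from `0`.
  let U : Set (Vec d) := {z | g.symm z ∈ Ω.cone ∧ |coordSum d z - (d + 1)| < 3 / 4}
  have hgs : Continuous g.symm := g.symm.toLinearMap.continuous_of_finiteDimensional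
  have hUo : IsOpen U := (Ω.isSharpCone.isOpen.preimage hgs).inter
    (isOpen_lt ((continuous_coordSum.sub continuous_const).abs) continuous_const)
  have hUc : Convex ℝ U := by
    have h1 : U = g.symm ⁻¹' Ω.cone ∩ coordSum d ⁻¹' Metric.ball ((d : ℝ) + 1) (3 / 4) := by
      ext z
      rw [mem_inter_iff, mem_preimage, mem_preimage, Metric.mem_ball, Real.dist_eq]
      rfl
    rw [h1]
    exact (Ω.isSharpCone.convex.linear_preimage g.symm.toLinearMap).inter
      ((convex_ball _ _).linear_preimage (coordSum d))
  have hUbox : closure U ⊆ normalBox d := by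
    refine closure_minimal (fun z hz => ⟨fun i => ?_, hz.2.le⟩) isCompact_normalBox.isClosed
    have h1 := (hn i).1 _ hz.1
    rwa [← hgi, g.apply_symm_apply] at h1
  have hball : Metric.closedBall (ones d) (normalRadius d) ⊆ U := by
    intro z hz
    rw [mem_closedBall_iff_norm] at hz
    have hd : (0 : ℝ) < d + 1 := by positivity
    have h1 : ∑ i, |z i - 1| ≤ 1 / 2 := by
      have h2 : ∀ i, |z i - 1| ≤ normalRadius d := fun i =>
        (PiLp.norm_apply_le (z - ones d) i).trans hz
      calc ∑ i, |z i - 1| ≤ ∑ _i : Fin (d + 1), normalRadius d := Finset.sum_le_sum fun i _ => h2 i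
        _ = 1 / 2 := by
          rw [Finset.sum_const, Finset.card_univ, Fintype.card_fin, nsmul_eq_mul, normalRadius]
          push_cast
          field_simp
    refine ⟨?_, ?_⟩
    -- A separating `m` would satisfy `inner ℝ m (g.symm z - a) ≤ -1`, but its coefficients in `[-1,
    -- 1]` make this at least `-1 / 2`.
    · by_contra hnot
      obtain ⟨m, hm, hm0⟩ := Ω.isSharpCone.exists_mem_dualSlice_inner_nonpos ha hnot
      obtain ⟨c, hc, hmc⟩ := hcoef m hm
      have h2 : inner ℝ m (g.symm z - a) = ∑ i, c i * (z i - 1) := by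
        rw [hmc, sum_inner]
        refine Finset.sum_congr rfl fun i _ => ?_
        rw [real_inner_smul_left, inner_sub_right, ← hgi, ← hgi, g.apply_symm_apply, hga]
        rfl
      rw [inner_sub_right, hm.2] at h2
      have h3 : |∑ i, c i * (z i - 1)| ≤ ∑ i, |z i - 1| := by
        refine (Finset.abs_sum_le_sum_abs _ _).trans (Finset.sum_le_sum fun i _ => ?_)
        rw [abs_mul]
        exact mul_le_of_le_one_left (abs_nonneg _) (hc i)
      have := (abs_le.mp h3).1
      linarith
    · have h2 : coordSum d z - (d + 1) = ∑ i, (z i - 1) := by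
        rw [coordSum_apply, Finset.sum_sub_distrib]; simp
      rw [h2]
      have := Finset.abs_sum_le_sum_abs (fun i => z i - 1) Finset.univ
      linarith
  have hUne : U.Nonempty := ⟨ones d, hball (Metric.mem_closedBall_self normalRadius_pos.le)⟩
  let A : normalBodies d := ⟨⟨⟨closure U, isCompact_normalBox.of_isClosed_subset isClosed_closure
    hUbox⟩, hUne.closure⟩, hUc.closure, hball.trans subset_closure, hUbox⟩
  have hAU : interior (A.1 : Set (Vec d)) = U := by
    change interior (closure U) = U
    rw [hUc.interior_closure_eq_interior_of_nonempty_interior (by rwa [hUo.interior_eq]),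
      hUo.interior_eq]
  refine ⟨n, g, A, hn, hgi, hga, ?_, hcoef⟩
  refine ProperlyConvexOpen.ext ?_
  change projMap g '' Ω.carrier = {x | ∃ y ∈ interior (A.1 : Set (Vec d)), ∃ h : y ≠ 0,
    Projectivization.mk ℝ y h = x}
  rw [hAU]
  ext x
  constructor
  · rintro ⟨x, hx, rfl⟩
    obtain ⟨y, hy, hy0, rfl⟩ := Ω.exists_mem_coneSection hx
    have hpos : 0 < coordSum d (g y) := by
      rw [coordSum_apply]
      refine Finset.sum_pos (fun i _ => ?_) Finset.univ_nonempty
      rw [hgi]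
      exact inner_pos_of_mem_dualSlice Ω.isSharpCone.isOpen (hn i) hy.1
    have hk : 0 < (d + 1) / coordSum d (g y) := by positivity
    refine ⟨((d + 1) / coordSum d (g y)) • g y, ⟨?_, ?_⟩,
      smul_ne_zero hk.ne' ((map_ne_zero_iff g g.injective).mpr hy0), ?_⟩
    · rw [map_smul, g.symm_apply_apply]
      exact Ω.isSharpCone.smul_mem hk hy.1
    · rw [map_smul, smul_eq_mul, div_mul_cancel₀ _ hpos.ne', sub_self, abs_zero]
      norm_num
    · exact (Projectivization.mk_eq_mk_iff' ℝ _ _ _ _).mpr ⟨_, rfl⟩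
  · rintro ⟨z, hz, hz0, rfl⟩
    obtain ⟨-, h1, h2⟩ := hz.1
    refine ⟨_, h2, ?_⟩
    rw [projMap_mk]
    congr 1
    exact g.apply_symm_apply z

theorem ProjectiveMetric.IsNatural.exists_bounds {F : ProjectiveMetric d} (hF : F.IsNatural) :
    ∃ m M : ℝ, 0 < m ∧ 0 < M ∧ ∀ (Ω : ProperlyConvexOpen d) (x : Proj d) (hx : x ∈ Ω)
      (φ : ProjTangent x),
      m * F.norm Ω x hx φ ≤ hilbertNorm Ω x φ ∧ hilbertNorm Ω x φ ≤ M * F.norm Ω x hx φ := by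
  obtain ⟨m, M, hm, hM, hb⟩ := hF.exists_bounds_normalSet
  have hd : (0 : ℝ) < d + 1 := by positivity
  refine ⟨(2 * M * (d + 1))⁻¹, (d + 1) / m, by positivity, by positivity, ?_⟩
  intro Ω x hx φ
  obtain ⟨a, ha, ha0, rfl⟩ := Ω.exists_mem_coneSection hx
  obtain ⟨w, rfl⟩ := exists_mkDeriv_eq φ
  obtain ⟨n, g, A, hn, hgi, hga, hmap, hcoef⟩ := exists_map_eq_normalSet Ω ha.1
  -- Subtracting this multiple of `ones d` makes the coordinate sum `0` without changing the tangent
  -- vector.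
  set c : ℝ := coordSum d (g w) / (d + 1) with hc
  set z : Vec d := g w + (-c) • ones d with hz
  have hz0 : coordSum d z = 0 := by
    rw [hz, map_add, map_smul, coordSum_ones, hc, smul_eq_mul]
    field_simp
    ring
  have hzi : ∀ i, z i = inner ℝ (n i) w - c := by
    intro i
    rw [hz, ← hgi]
    simp [ones, sub_eq_add_neg]
  have hFz : F.norm Ω (Projectivization.mk ℝ a ha0) hx (mkDeriv a ha0 w) =
      F.liftNorm (normalSet A) (ones d) ones_ne_zero (mk_ones_mem_normalSet A) z := by
    have h1 := hF.liftNorm_map g Ω a ha0 hx w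
    have h2 := F.liftNorm_congr (g w) hmap hga ones_ne_zero (mk_ones_mem_normalSet A)
      (hu := (map_ne_zero_iff g g.injective).mpr ha0) (h := projMap_mem_map g hx)
    rw [hz, ProjectiveMetric.liftNorm, mkDeriv_add_smul_self]
    exact h1.symm.trans h2
  obtain ⟨hb1, hb2⟩ := hb A z hz0
  rw [← hFz] at hb1 hb2
  set N := F.norm Ω (Projectivization.mk ℝ a ha0) hx (mkDeriv a ha0 w)
  have hsum : ∑ i, |z i| ≤ (d + 1) * ‖z‖ := by
    calc ∑ i, |z i| ≤ ∑ _i : Fin (d + 1), ‖z‖ :=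
          Finset.sum_le_sum fun i _ => PiLp.norm_apply_le z i
      _ = (d + 1) * ‖z‖ := by simp
  constructor
  · set H := hilbertNorm Ω (Projectivization.mk ℝ a ha0) (mkDeriv a ha0 w)
    have h1 : ∀ i j, z i - z j ≤ 2 * H := by
      intro i j
      have h2 := le_hilbertNorm Ω ha0 hx w (hn j) (hn i)
      rw [(hn i).2, (hn j).2, div_one, div_one] at h2
      rw [hzi, hzi]
      linarith
    rw [coordSum_apply] at hz0
    -- The coordinates have sum `0`, so averaging the bounds on `z i - z j` over `j` bounds `z i`
    -- itself.
    have h2 : ∀ i, |z i| ≤ 2 * H := by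
      intro i
      have e : ∀ t : ℝ, ((d : ℝ) + 1) * t = ∑ _j : Fin (d + 1), t := fun t => by simp
      refine abs_le.mpr ⟨?_, ?_⟩
      · have h3 : ∑ j, (z j - z i) ≤ ∑ _j : Fin (d + 1), 2 * H :=
          Finset.sum_le_sum fun j _ => h1 j i
        rw [Finset.sum_sub_distrib, hz0, ← e, ← e] at h3
        nlinarith
      · have h3 : ∑ j, (z i - z j) ≤ ∑ _j : Fin (d + 1), 2 * H :=
          Finset.sum_le_sum fun j _ => h1 i j
        rw [Finset.sum_sub_distrib, hz0, ← e, ← e] at h3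
        nlinarith
    have h3 : ‖z‖ ≤ (d + 1) * (2 * H) := by
      refine (norm_le_sum_abs z).trans ((Finset.sum_le_sum fun i _ => h2 i).trans_eq ?_)
      simp
    rw [inv_mul_le_iff₀ (by positivity)]
    calc N ≤ M * ‖z‖ := hb2
      _ ≤ M * ((d + 1) * (2 * H)) := by gcongr
      _ = 2 * M * (d + 1) * H := by ring
  · obtain ⟨k, hk, k', hk', h⟩ := exists_hilbertNorm_eq Ω ha0 ha w
    -- The coefficients of `k` on the simplex lie in `[-1, 1]` and have sum `1`, since all these
    -- forms are `1` at `a`.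
    have h1 : ∀ k ∈ dualSlice Ω.cone a, |inner ℝ k w - c| ≤ (d + 1) * ‖z‖ := by
      intro k hk
      obtain ⟨e, he, hke⟩ := hcoef k hk
      have h2 : ∑ i, e i = 1 := by
        rw [← hk.2, hke, sum_inner]
        refine Finset.sum_congr rfl fun i _ => ?_
        rw [real_inner_smul_left, (hn i).2, mul_one]
      have h3 : inner ℝ k w - c = ∑ i, e i * z i := by
        simp only [hzi, mul_sub, Finset.sum_sub_distrib]
        rw [← Finset.sum_mul, h2, one_mul, hke, sum_inner]
        simp only [real_inner_smul_left]
      rw [h3]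
      refine ((Finset.abs_sum_le_sum_abs _ _).trans (Finset.sum_le_sum fun i _ => ?_)).trans hsum
      rw [abs_mul]
      exact mul_le_of_le_one_left (abs_nonneg _) (he i)
    have h2 := abs_le.mp (h1 k hk)
    have h3 := abs_le.mp (h1 k' hk')
    have h4 : hilbertNorm Ω (Projectivization.mk ℝ a ha0) (mkDeriv a ha0 w) ≤ (d + 1) * ‖z‖ := by
      rw [h]; linarith
    refine h4.trans ?_
    rw [div_mul_eq_mul_div, le_div_iff₀ hm, mul_assoc, mul_comm ‖z‖]
    gcongr

/-! ### Lengths of paths -/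

theorem integral_unitInterval_eq_sub {h h' : ℝ → ℝ}
    (hh : ∀ t ∈ Icc (0 : ℝ) 1, HasDerivWithinAt h (h' t) (Icc 0 1) t)
    (hc : ContinuousOn h' (Icc 0 1)) :
    ∫ t : unitInterval, h' t = h 1 - h 0 := by
  have h1 : ∫ t : unitInterval, h' t = ∫ t in Icc (0 : ℝ) 1, h' t :=
    MeasureTheory.integral_subtype measurableSet_Icc h'
  rw [h1, MeasureTheory.integral_Icc_eq_integral_Ioc,
    ← intervalIntegral.integral_of_le zero_le_one]
  refine intervalIntegral.integral_eq_sub_of_hasDerivAt_of_le zero_le_one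
    (fun t ht => (hh t ht).continuousWithinAt) (fun t ht => ?_) ?_
  · exact (hh t (Ioo_subset_Icc_self ht)).hasDerivAt (Icc_mem_nhds ht.1 ht.2)
  · exact hc.intervalIntegrable_of_Icc zero_le_one

theorem integral_unitInterval_mono {f g : unitInterval → ℝ} (hf : Continuous f)
    (hg : Continuous g) (h : ∀ t, f t ≤ g t) : ∫ t, f t ≤ ∫ t, g t :=
  MeasureTheory.integral_mono (hf.integrable_of_hasCompactSupport (HasCompactSupport.of_compactSpace f))
    (hg.integrable_of_hasCompactSupport (HasCompactSupport.of_compactSpace g)) h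

theorem C1Path.continuous_lift {Ω : ProperlyConvexOpen d} {x y : Proj d} (γ : C1Path Ω x y) :
    Continuous fun t : unitInterval => γ.lift t :=
  continuousOn_iff_continuous_domRestrict.mp γ.contDiffOn.continuousOn

theorem C1Path.continuousOn_derivWithin {Ω : ProperlyConvexOpen d} {x y : Proj d}
    (γ : C1Path Ω x y) : ContinuousOn (derivWithin γ.lift (Icc 0 1)) (Icc 0 1) :=
  γ.contDiffOn.continuousOn_derivWithin (uniqueDiffOn_Icc zero_lt_one) le_rfl

theorem ProjectiveMetric.IsNatural.continuous_speed {F : ProjectiveMetric d} (hF : F.IsNatural)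
    {Ω : ProperlyConvexOpen d} {x y : Proj d} (γ : C1Path Ω x y) :
    Continuous fun t : unitInterval => F.norm Ω (Projectivization.mk ℝ (γ.lift t) (γ.ne_zero t))
      (γ.mem t) (mkDeriv (γ.lift t) (γ.ne_zero t) (derivWithin γ.lift (Icc 0 1) t)) :=
  hF.continuous_liftNorm continuous_const γ.continuous_lift
    (continuousOn_iff_continuous_domRestrict.mp γ.continuousOn_derivWithin) γ.ne_zero γ.mem

theorem ProjectiveMetric.length_nonneg (F : ProjectiveMetric d) {Ω : ProperlyConvexOpen d}
    {x y : Proj d} (γ : C1Path Ω x y) : 0 ≤ F.length γ :=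
  MeasureTheory.integral_nonneg fun _ => apply_nonneg _ _

theorem ProjectiveMetric.dist_le_length (F : ProjectiveMetric d) {Ω : ProperlyConvexOpen d}
    {x y : Proj d} (γ : C1Path Ω x y) : F.dist Ω x y ≤ F.length γ :=
  ciInf_le ⟨0, by rintro _ ⟨γ, rfl⟩; exact F.length_nonneg γ⟩ γ

/-! ### Segments, arbitrary paths and the Hilbert distance. -/

theorem add_smul_sub_mem_coneSection {K : Set (Vec d)} {f : Module.Dual ℝ (Vec d)}
    (hK : IsSharpCone K f) {a b : Vec d} (ha : a ∈ coneSection K f) (hb : b ∈ coneSection K f)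
    {t : ℝ} (ht : t ∈ Icc (0 : ℝ) 1) : a + t • (b - a) ∈ coneSection K f := by
  refine ⟨?_, by simp [ha.2, hb.2]⟩
  have := hK.convex ha.1 hb.1 (sub_nonneg.mpr ht.2) ht.1 (sub_add_cancel 1 t)
  convert this using 1
  module

theorem hasDerivAt_segment (a v : Vec d) (t : ℝ) : HasDerivAt (fun t : ℝ => a + t • v) v t := by
  simpa using ((hasDerivAt_id t).smul_const v).const_add a

/-- The path along a segment of an affine chart. -/
def segmentPath (Ω : ProperlyConvexOpen d) {a b : Vec d} (ha0 : a ≠ 0) (hb0 : b ≠ 0)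
    (ha : a ∈ coneSection Ω.cone Ω.chart) (hb : b ∈ coneSection Ω.cone Ω.chart) :
    C1Path Ω (Projectivization.mk ℝ a ha0) (Projectivization.mk ℝ b hb0) where
  lift t := a + t • (b - a)
  contDiffOn := by
    refine ContDiff.contDiffOn ?_
    fun_prop
  ne_zero t := (Ω.mk_mem_of_mem_coneSection
    (add_smul_sub_mem_coneSection Ω.isSharpCone ha hb t.2)).1
  mem t := (Ω.mk_mem_of_mem_coneSection
    (add_smul_sub_mem_coneSection Ω.isSharpCone ha hb t.2)).2
  source := by
    congr 1
    simp
  target := by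
    congr 1
    simp

theorem derivWithin_segmentPath (Ω : ProperlyConvexOpen d) {a b : Vec d} (ha0 : a ≠ 0)
    (hb0 : b ≠ 0) (ha : a ∈ coneSection Ω.cone Ω.chart) (hb : b ∈ coneSection Ω.cone Ω.chart)
    (t : unitInterval) : derivWithin (segmentPath Ω ha0 hb0 ha hb).lift (Icc 0 1) t = b - a :=
  (hasDerivAt_segment a (b - a) t).hasDerivWithinAt.derivWithin
    (uniqueDiffOn_Icc zero_lt_one _ t.2)

theorem hilbertNorm_mk_of_mem_coneSection (Ω : ProperlyConvexOpen d) {a v : Vec d} (ha0 : a ≠ 0)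
    (ha : a ∈ coneSection Ω.cone Ω.chart) (hv : Ω.chart v = 0) :
    hilbertNorm Ω (Projectivization.mk ℝ a ha0) (mkDeriv a ha0 v) = 1 / 2 *
      ((exitTime (coneSection Ω.cone Ω.chart) a (-v))⁻¹ +
        (exitTime (coneSection Ω.cone Ω.chart) a v)⁻¹) := by
  rw [hilbertNorm, chartCoordDeriv_mkDeriv _ _ _ (by rw [ha.2]; exact one_ne_zero), chartCoord_mk,
    Ω.image_chartCoord, ha.2, inv_one, one_smul, one_smul, mul_one, hv, zero_smul, sub_zero,
    Ω.isSharpCone.affineHilbertNorm_eq ha hv]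

theorem hilbertDist_mk_of_mem_coneSection (Ω : ProperlyConvexOpen d) {a b : Vec d} (ha0 : a ≠ 0)
    (hb0 : b ≠ 0) (ha : a ∈ coneSection Ω.cone Ω.chart) (hb : b ∈ coneSection Ω.cone Ω.chart) :
    hilbertDist Ω (Projectivization.mk ℝ a ha0) (Projectivization.mk ℝ b hb0) =
      affineHilbertDist (coneSection Ω.cone Ω.chart) a b := by
  rw [hilbertDist, chartCoord_mk, chartCoord_mk, Ω.image_chartCoord, ha.2, hb.2, inv_one, one_smul,
    one_smul]

/-- At time `t` the exit times are `T' + t` and `T - t`, so the Hilbert speed is the derivative of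
`½ (log (T' + t) - log (T - t))`, whose increment over `[0, 1]` is the Hilbert distance. -/
theorem mul_length_segmentPath_le {F : ProjectiveMetric d} (hF : F.IsNatural) {m : ℝ}
    (hb : ∀ (Ω : ProperlyConvexOpen d) (x : Proj d) (hx : x ∈ Ω) (φ : ProjTangent x),
      m * F.norm Ω x hx φ ≤ hilbertNorm Ω x φ)
    (Ω : ProperlyConvexOpen d) {a b : Vec d} (ha0 : a ≠ 0) (hb0 : b ≠ 0)
    (ha : a ∈ coneSection Ω.cone Ω.chart) (hbs : b ∈ coneSection Ω.cone Ω.chart) :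
    m * F.length (segmentPath Ω ha0 hb0 ha hbs) ≤
      hilbertDist Ω (Projectivization.mk ℝ a ha0) (Projectivization.mk ℝ b hb0) := by
  set γ := segmentPath Ω ha0 hb0 ha hbs with hγ
  have hsec : ∀ t : unitInterval, γ.lift t ∈ coneSection Ω.cone Ω.chart := fun t =>
    add_smul_sub_mem_coneSection Ω.isSharpCone ha hbs t.2
  have hfv : Ω.chart (b - a) = 0 := by simp [ha.2, hbs.2]
  rw [hilbertDist_mk_of_mem_coneSection Ω ha0 hb0 ha hbs, ProjectiveMetric.length,
    ← MeasureTheory.integral_const_mul]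
  have hcont := (hF.continuous_speed γ).const_mul m
  rcases eq_or_ne a b with rfl | hab
  · rw [affineHilbertDist, if_pos rfl]
    refine MeasureTheory.integral_nonpos fun t => ?_
    change m * _ ≤ 0
    rw [derivWithin_segmentPath, sub_self]
    have h0 : mkDeriv (γ.lift t) (γ.ne_zero t) 0 = 0 := by
      have := mkDeriv_smul (γ.lift t) (γ.ne_zero t) 0 0
      rwa [zero_smul, zero_smul] at this
    rw [h0, map_zero, mul_zero]
  have hv : b - a ≠ 0 := sub_ne_zero.mpr hab.symm
  have hK := Ω.isSharpCone
  have hT' := hK.exitTime_pos ha (neg_ne_zero.mpr hv) (by simp [ha.2, hbs.2])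
  have hT1 := (hK.add_smul_mem_coneSection_iff ha hv hfv zero_le_one).mp (by simpa using hbs)
  rw [hK.affineHilbertDist_eq ha hbs hab]
  set T := exitTime (coneSection Ω.cone Ω.chart) a (b - a) with hTdef
  set T' := exitTime (coneSection Ω.cone Ω.chart) a (-(b - a)) with hTdef'
  have hp : ∀ t ∈ Icc (0 : ℝ) 1, T' + t ≠ 0 ∧ T - t ≠ 0 := fun t ht =>
    ⟨by linarith [ht.1], by linarith [ht.2]⟩
  have hder : ∀ t ∈ Icc (0 : ℝ) 1, HasDerivWithinAt
      (fun t => 1 / 2 * (Real.log (T' + t) - Real.log (T - t)))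
      (1 / 2 * ((T' + t)⁻¹ + (T - t)⁻¹)) (Icc 0 1) t := by
    intro t ht
    have h1 := ((hasDerivAt_id t).const_add T').log (hp t ht).1
    have h2 := ((hasDerivAt_id t).const_sub T).log (hp t ht).2
    convert! ((h1.sub h2).const_mul (1 / 2 : ℝ)).hasDerivWithinAt using 1
    simp only [id]
    ring
  have hcont' : ContinuousOn (fun t => 1 / 2 * ((T' + t)⁻¹ + (T - t)⁻¹)) (Icc 0 1) := by
    refine continuousOn_const.mul (ContinuousOn.add ?_ ?_)
    · exact (continuousOn_const.add continuousOn_id).inv₀ fun t ht => (hp t ht).1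
    · exact (continuousOn_const.sub continuousOn_id).inv₀ fun t ht => (hp t ht).2
  have hint := integral_unitInterval_eq_sub hder hcont'
  simp only [add_zero, sub_zero] at hint
  refine (integral_unitInterval_mono hcont (continuousOn_iff_continuous_domRestrict.mp hcont')
    fun t => ?_).trans_eq (hint.trans (by ring))
  refine (hb Ω _ (γ.mem t) _).trans_eq ?_
  rw [derivWithin_segmentPath, hilbertNorm_mk_of_mem_coneSection Ω (γ.ne_zero t) (hsec t) hfv]
  have e1 := hK.exitTime_add_smul ha hv hfv t.2.1 (hsec t)
  have e2 := hK.exitTime_add_smul_neg ha hv hfv t.2.1 (hsec t)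
  change 1 / 2 * ((exitTime _ (a + (t : ℝ) • (b - a)) _)⁻¹ +
    (exitTime _ (a + (t : ℝ) • (b - a)) _)⁻¹) = _
  rw [e1, e2]
  rfl

/-- A lifted path meets the chosen lifts of its endpoints only up to a nonzero scalar, possibly
negative; it cancels because `Real.log` depends only on the absolute value. -/
theorem log_inner_smul_sub {n n' u a : Vec d} {c : ℝ} (hu : c • u = a) (ha : inner ℝ n a ≠ 0)
    (ha' : inner ℝ n' a ≠ 0) :
    Real.log (inner ℝ n' u) - Real.log (inner ℝ n u) =
      Real.log (inner ℝ n' a) - Real.log (inner ℝ n a) := by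
  rw [← hu, inner_smul_right] at ha ha'
  rw [← hu, inner_smul_right, inner_smul_right,
    Real.log_mul (left_ne_zero_of_mul ha) (right_ne_zero_of_mul ha),
    Real.log_mul (left_ne_zero_of_mul ha') (right_ne_zero_of_mul ha')]
  ring

/-- A calibration argument: for the pair `n`, `n'` realizing the distance, `½ log (n' / n)`
increases along the path by the Hilbert distance, at a rate at most the Hilbert norm of the
velocity. -/
theorem hilbertDist_le_mul_length {F : ProjectiveMetric d} (hF : F.IsNatural) {M : ℝ}
    (hb : ∀ (Ω : ProperlyConvexOpen d) (x : Proj d) (hx : x ∈ Ω) (φ : ProjTangent x),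
      hilbertNorm Ω x φ ≤ M * F.norm Ω x hx φ)
    (Ω : ProperlyConvexOpen d) {x y : Proj d} (hx : x ∈ Ω) (hy : y ∈ Ω) (γ : C1Path Ω x y) :
    hilbertDist Ω x y ≤ M * F.length γ := by
  obtain ⟨a, ha, ha0, rfl⟩ := Ω.exists_mem_coneSection hx
  obtain ⟨b, hbs, hb0, rfl⟩ := Ω.exists_mem_coneSection hy
  rw [hilbertDist_mk_of_mem_coneSection Ω ha0 hb0 ha hbs]
  have hK := Ω.isSharpCone
  obtain ⟨n, hn, n', hn', hd⟩ := hK.exists_affineHilbertDist_eq ha hbs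
  have hne : ∀ {k}, k ∈ dualSlice Ω.cone a → ∀ t : unitInterval, inner ℝ k (γ.lift t) ≠ 0 := by
    intro k hk t
    have h1 := inner_pos_of_mem_dualSlice hK.isOpen hk
      (Ω.inv_smul_mem_coneSection (γ.ne_zero t) (γ.mem t)).1
    rw [inner_smul_right] at h1
    exact right_ne_zero_of_mul h1.ne'
  have hderk : ∀ (k : Vec d), ∀ t ∈ Icc (0 : ℝ) 1, HasDerivWithinAt
      (fun t => inner ℝ k (γ.lift t)) (inner ℝ k (derivWithin γ.lift (Icc 0 1) t)) (Icc 0 1) t := by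
    intro k t ht
    have h1 := (γ.contDiffOn.differentiableOn one_ne_zero t ht).hasDerivWithinAt
    exact (innerSL ℝ k).hasFDerivAt.comp_hasDerivWithinAt t h1
  have hder : ∀ t ∈ Icc (0 : ℝ) 1, HasDerivWithinAt
      (fun t => 1 / 2 * (Real.log (inner ℝ n' (γ.lift t)) - Real.log (inner ℝ n (γ.lift t))))
      (1 / 2 * (inner ℝ n' (derivWithin γ.lift (Icc 0 1) t) / inner ℝ n' (γ.lift t) -
        inner ℝ n (derivWithin γ.lift (Icc 0 1) t) / inner ℝ n (γ.lift t))) (Icc 0 1) t := by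
    intro t ht
    exact (((hderk n' t ht).log (hne hn' ⟨t, ht⟩)).sub
      ((hderk n t ht).log (hne hn ⟨t, ht⟩))).const_mul _
  have hcont : ContinuousOn (fun t =>
      1 / 2 * (inner ℝ n' (derivWithin γ.lift (Icc 0 1) t) / inner ℝ n' (γ.lift t) -
        inner ℝ n (derivWithin γ.lift (Icc 0 1) t) / inner ℝ n (γ.lift t))) (Icc 0 1) := by
    have h1 := γ.continuousOn_derivWithin
    have h2 := γ.contDiffOn.continuousOn
    exact continuousOn_const.mul
      (((continuousOn_const.inner h1).div (continuousOn_const.inner h2)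
        fun t ht => hne hn' ⟨t, ht⟩).sub
      ((continuousOn_const.inner h1).div (continuousOn_const.inner h2)
        fun t ht => hne hn ⟨t, ht⟩))
  have hint := integral_unitInterval_eq_sub hder hcont
  obtain ⟨c₀, hc₀⟩ := (Projectivization.mk_eq_mk_iff' ℝ _ _ _ _).mp γ.source.symm
  obtain ⟨c₁, hc₁⟩ := (Projectivization.mk_eq_mk_iff' ℝ _ _ _ _).mp γ.target.symm
  have hpos : ∀ {k z}, k ∈ dualSlice Ω.cone a → z ∈ Ω.cone → inner ℝ k z ≠ 0 := fun hk hz =>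
    (inner_pos_of_mem_dualSlice hK.isOpen hk hz).ne'
  have h0 := log_inner_smul_sub (u := γ.lift 0) hc₀ (hpos hn ha.1) (hpos hn' ha.1)
  have h1 := log_inner_smul_sub (u := γ.lift 1) hc₁ (hpos hn hbs.1) (hpos hn' hbs.1)
  rw [h0, h1, hn.2, hn'.2, sub_self, mul_zero, sub_zero] at hint
  rw [hd, ← hint, ProjectiveMetric.length, ← MeasureTheory.integral_const_mul]
  refine integral_unitInterval_mono (continuousOn_iff_continuous_domRestrict.mp hcont)
    ((hF.continuous_speed γ).const_mul M) fun t => ?_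
  exact (le_hilbertNorm Ω (γ.ne_zero t) (γ.mem t) _ hn hn').trans (hb Ω _ (γ.mem t) _)

theorem ProjectiveMetric.IsNatural.exists_bilipschitz {F : ProjectiveMetric d} (hF : F.IsNatural) :
    ∃ a b : ℝ, 0 < a ∧ a < b ∧
      (∀ (Ω : ProperlyConvexOpen d) (x : Proj d) (hx : x ∈ Ω) (φ : ProjTangent x),
        a * F.norm Ω x hx φ ≤ hilbertNorm Ω x φ ∧ hilbertNorm Ω x φ ≤ b * F.norm Ω x hx φ) ∧
      (∀ (Ω : ProperlyConvexOpen d) (x y : Proj d), x ∈ Ω → y ∈ Ω →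
        a * F.dist Ω x y ≤ hilbertDist Ω x y ∧ hilbertDist Ω x y ≤ b * F.dist Ω x y) := by
  obtain ⟨m, M, hm, hM, h⟩ := hF.exists_bounds
  have hb : ∀ (Ω : ProperlyConvexOpen d) (x : Proj d) (hx : x ∈ Ω) (φ : ProjTangent x),
      hilbertNorm Ω x φ ≤ (m + M) * F.norm Ω x hx φ := fun Ω x hx φ =>
    (h Ω x hx φ).2.trans
      (mul_le_mul_of_nonneg_right (le_add_of_nonneg_left hm.le) (apply_nonneg _ _))
  -- The upper constant `m + M` instead of `M` makes the inequality between the constants strict.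
  refine ⟨m, m + M, hm, by linarith, fun Ω x hx φ => ⟨(h Ω x hx φ).1, hb Ω x hx φ⟩, ?_⟩
  intro Ω x y hx hy
  obtain ⟨a, ha, ha0, rfl⟩ := Ω.exists_mem_coneSection hx
  obtain ⟨b, hbs, hb0, rfl⟩ := Ω.exists_mem_coneSection hy
  -- Without a path, the infimum defining the distance would be a default value.
  have : Nonempty (C1Path Ω (Projectivization.mk ℝ a ha0) (Projectivization.mk ℝ b hb0)) :=
    ⟨segmentPath Ω ha0 hb0 ha hbs⟩
  constructor
  · exact (mul_le_mul_of_nonneg_left (F.dist_le_length _) hm.le).trans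
      (mul_length_segmentPath_le hF (fun Ω x hx φ => (h Ω x hx φ).1) Ω ha0 hb0 ha hbs)
  · rw [← div_le_iff₀' (by positivity)]
    refine le_ciInf fun γ => ?_
    rw [div_le_iff₀' (by positivity)]
    exact hilbertDist_le_mul_length hF hb Ω hx hy γ

end HilbertGeometry

theorem mainTheorem10 (d : ℕ) :
    (∀ F : ProjectiveMetric d, F.IsNatural →
      ∃ a b : ℝ, 0 < a ∧ a < b ∧
        (∀ (Ω : ProperlyConvexOpen d) (x : Proj d) (hx : x ∈ Ω) (φ : ProjTangent x),
          a * F.norm Ω x hx φ ≤ hilbertNorm Ω x φ ∧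
          hilbertNorm Ω x φ ≤ b * F.norm Ω x hx φ) ∧
        (∀ (Ω : ProperlyConvexOpen d) (x y : Proj d), x ∈ Ω → y ∈ Ω →
          a * F.dist Ω x y ≤ hilbertDist Ω x y ∧
          hilbertDist Ω x y ≤ b * F.dist Ω x y)) ∧
    (∀ F F' : ProjectiveMetric d, F.IsNatural → F'.IsNatural →
      ∃ a b : ℝ, 0 < a ∧ a < b ∧
        ∀ (Ω : ProperlyConvexOpen d) (x y : Proj d), x ∈ Ω → y ∈ Ω →
          a * F.dist Ω x y ≤ F'.dist Ω x y ∧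
          F'.dist Ω x y ≤ b * F.dist Ω x y) := by
  refine ⟨fun F hF => hF.exists_bilipschitz, fun F F' hF hF' => ?_⟩
  obtain ⟨a, b, ha, hab, -, h⟩ := hF.exists_bilipschitz
  obtain ⟨a', b', ha', hab', -, h'⟩ := hF'.exists_bilipschitz
  have hb := ha.trans hab
  have hb' := ha'.trans hab'
  refine ⟨a / b', b / a', by positivity, div_lt_div₀ hab hab'.le hb.le ha', ?_⟩
  intro Ω x y hx hy
  obtain ⟨h1, h2⟩ := h Ω x y hx hy
  obtain ⟨h3, h4⟩ := h' Ω x y hx hy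
  constructor
  · rw [div_mul_eq_mul_div, div_le_iff₀' hb']
    exact h1.trans h4
  · rw [div_mul_eq_mul_div, le_div_iff₀' ha']
    exact h3.trans h2
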